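/- **Setting.** Let $\mathcal H$ be a finite-dimensional Hilbert space of dimension $d$, identified with $\mathbb C^d$ by an orthonormal basis, $\mathcal B(\mathcal H)$ the algebra of operators on $\mathcal H$ with operator norm $\|\cdot\|_\infty$, and $\mathcal D_+(\mathcal H)$ the set of full-rank density operators. Let $(\Lambda_t)_{t\ge 0}$ be a quantum Markov semigroup on $\mathcal B(\mathcal H)$ (completely positive unital maps with $\Lambda_0=\mathrm{id}$, $\Lambda_{s+t}=\Lambda_s\Lambda_t$, $\|\Lambda_t(f)-f\|_\infty\to0$ as $t\to 0$) that is primitive, i.e. has a unique invariant state $\sigma$, and $\sigma\in\mathcal D_+(\mathcal H)$. Suppose that its generator has the detailed-balance form $$\mathcal L(f)=\sum_{j\in\mathcal J}c_j\left(e^{-\omega_j/2}\tilde L_j^*[f,\tilde L_j]+e^{\omega_j/2}[\tilde L_j,f]\tilde L_j^*\right),$$ where $\mathcal J$ is finite, $c_j>0$, $\omega_j\in\mathbb R$, $\{\tilde L_j\}=\{\tilde L_j^*\}$, $\sigma\tilde L_j\sigma^{-1}=e^{-\omega_j}\tilde L_j$, $\frac1d\mathrm{Tr}(\tilde L_j^*\tilde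 L_k)=\delta_{kj}$, $\mathrm{Tr}\,\tilde L_j=0$, and $c_j=c_{j'}$ whenever $\tilde L_j^*=\tilde L_{j'}$. **Notation.** For $\rho\in\mathcal D_+(\mathcal H)$ let $\Delta_\rho(A)=\rho A\rho^{-1}$, $R_\rho(A)=A\rho$, and for $\omega\in\mathbb R$ $$[\rho]_\omega=R_\rho\circ f_\omega(\Delta_\rho),\qquad f_\omega(t)=e^{\omega/2}\,\frac{t-e^{-\omega}}{\log t+\omega}\quad(t>0),$$ with $f_\omega(e^{-\omega})=e^{-\omega/2}$ by continuity. Put $\partial_jU=[\tilde L_j,U]$, $\nabla U=(\partial_jU)_j$, $[\rho]_{\vec\omega}\mathbf A=([\rho]_{\omega_j}A_j)_j$, $\operatorname{div}\mathbf A=\sum_jc_j[A_j,\tilde L_j^*]$ and $\|\mathbf V\|^2_{\mathcal L,\rho}=\sum_jc_j\mathrm{Tr}(V_j^*[\rho]_{\omega_j}V_j)$. The Wasserstein distance is $$W_{2,\mathcal L}(\rho,\sigma)=\inf\Big(\int_0^1\|\nabla U(s)\|^2_{\mathcal L,\gamma(s)}\,ds\Big)^{1/2},$$ the infimum being over smooth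 paths $\gamma:[0,1]\to\mathcal D_+(\mathcal H)$ with $\gamma(0)=\rho$, $\gamma(1)=\sigma$ and self-adjoint traceless $U(s)$ such that $\dot\gamma(s)=-\operatorname{div}([\gamma(s)]_{\vec\omega}\nabla U(s))$ for all $s\in[0,1]$. Further, $D(\rho\|\sigma)=\mathrm{Tr}(\rho(\log\rho-\log\sigma))$ and $\langle f,g\rangle_{1/2,\sigma}=\mathrm{Tr}(f^*R_\sigma\Delta_\sigma^{1/2}(g))=\mathrm{Tr}(\sigma^{1/2}f^*\sigma^{1/2}g)$. **Theorem.** Let $c_2>0$, and suppose that $(\Lambda_t)$ satisfies $\mathrm{TC}_2(c_2)$: $$W_{2,\mathcal L}(\rho,\sigma)\le\sqrt{2c_2D(\rho\|\sigma)}\qquad\text{for all }\rho\in\mathcal D_+(\mathcal H).$$ Then the Poincaré inequality with respect to $\langle\cdot,\cdot\rangle_{1/2,\sigma}$ holds with constant $\lambda=(c_2\kappa_{\mathcal L})^{-1}$: $$\lambda\,\langle f,f\rangle_{1/2,\sigma}\le-\langle f,\mathcal L(f)\rangle_{1/2,\sigma}\qquad\text{for all }f\in\mathcal B(\mathcal H)\text{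 with }\mathrm{Tr}(\sigma f)=0,$$ where $$\kappa_{\mathcal L}=\sup_{j\in\mathcal J}\big\|[\sigma]_{\omega_j}\circ[\sigma]_{-\omega_j}^{-1}\big\|_{\infty\to\infty},\qquad\|\Phi\|_{\infty\to\infty}=\sup_{A\ne0}\frac{\|\Phi(A)\|_\infty}{\|A\|_\infty}.$$ Moreover $\lambda>0$ if $\mathcal J\neq\emptyset$. (The set $\mathcal J$ is empty only if $d=1$; then $\kappa_{\mathcal L}$ and $\lambda$ are read as $0$, and the inequality is trivial.) -/

import Mathlib

open scoped Matrix MatrixOrder Matrix.Norms.L2Operator CStarAlgebra ComplexOrder NNReal ENNReal ContDiff Topology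
open MeasureTheory

noncomputable section

namespace QMS

/-- The algebra `B(H)` for `H = ℂⁿ`; its norm is the operator norm, its order the Loewner order. -/
abbrev Op (n : Type*) : Type _ := Matrix n n ℂ

/-- Superoperators: linear maps `B(H) → B(H)`. -/
abbrev SuperOp (n : Type*) : Type _ := Module.End ℂ (Op n)

section States

variable {n : Type*} [Fintype n] [DecidableEq n]

/-- `D(H)`: density operators. -/
def IsState (ρ : Op n) : Prop := ρ.PosSemidef ∧ ρ.trace = 1

/-- `D₊(H)`: full-rank density operators. -/
def IsFullRankState (ρ : Op n) : Prop := ρ.PosDef ∧ ρ.trace = 1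

/-- Umegaki's relative entropy `D(ρ‖σ) = Tr (ρ (log ρ - log σ))` of two full-rank states. -/
def relEntropy (ρ σ : Op n) : ℝ := (ρ * (CFC.log ρ - CFC.log σ)).trace.re

end States

section Modular

variable {n : Type*} [Fintype n] [DecidableEq n]

/-- The modular operator `Δ_ρ (A) = ρ A ρ⁻¹`. -/
def modularOp (ρ A : Op n) : Op n := ρ * A * ρ⁻¹

/-- The spectral projection `P_x(ρ)` of a self-adjoint `ρ`. -/
def specProj (ρ : Op n) (x : ℝ) : Op n := cfc (fun t : ℝ => if t = x then (1 : ℝ) else 0) ρ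

/-- The (finite) spectrum of `ρ`. -/
def specFinset (ρ : Op n) : Finset ℝ := (Matrix.finite_real_spectrum (A := ρ)).toFinset

/-- The functional calculus `φ(Δ_ρ)` of the modular operator of a full-rank state `ρ`:
`φ(Δ_ρ)(A) = ∑_{x, y ∈ sp ρ} φ(x / y) P_x(ρ) A P_y(ρ)`. -/
def modularFun (φ : ℝ → ℝ) (ρ : Op n) : SuperOp n :=
  ∑ x ∈ specFinset ρ, ∑ y ∈ specFinset ρ,
    (φ (x / y) : ℂ) •
      (LinearMap.mulLeft ℂ (specProj ρ x) ∘ₗ LinearMap.mulRight ℂ (specProj ρ y))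

/-- `R_ρ ∘ φ(Δ_ρ)`, where `R_ρ` is right multiplication by `ρ`. -/
def weightedOp (φ : ℝ → ℝ) (ρ : Op n) : SuperOp n :=
  LinearMap.mulRight ℂ ρ ∘ₗ modularFun φ ρ

/-- `⟨f, g⟩_{φ,σ} = Tr (f* (R_σ ∘ φ(Δ_σ)) (g))`. -/
def innerφ (φ : ℝ → ℝ) (σ f g : Op n) : ℂ := (fᴴ * weightedOp φ σ g).trace

/-- The function `φ_{1/2}(t) = t^{1/2}`, for which `⟨f, g⟩_{φ,σ} = Tr (σ^{1/2} f* σ^{1/2} g)`. -/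
def φHalf (t : ℝ) : ℝ := t ^ (1 / 2 : ℝ)

/-- `f_w(t) = e^{w/2} (t - e^{-w}) / (log t + w)` for `t > 0`, with its limit `e^{-w/2}` as value
at the removable singularity `t = e^{-w}`. -/
def fFreq (w t : ℝ) : ℝ :=
  if t = Real.exp (-w) then Real.exp (-w / 2)
  else Real.exp (w / 2) * (t - Real.exp (-w)) / (Real.log t + w)

/-- `[ρ]_w = R_ρ ∘ f_w(Δ_ρ)`. -/
def bracketOp (ρ : Op n) (w : ℝ) : SuperOp n := weightedOp (fFreq w) ρ

/-- `‖Φ‖_{∞→∞}`, the norm of a superoperator induced by the operator norm. -/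
def superNorm (Φ : SuperOp n) : ℝ := ‖LinearMap.toContinuousLinearMap Φ‖

end Modular

/-- A quantum Markov semigroup on `B(ℂⁿ)` in the Heisenberg picture. -/
structure QuantumMarkovSemigroup (n : Type*) [Fintype n] [DecidableEq n] where
  /-- The completely positive maps `Λ_t`, `t ≥ 0`. -/
  map : ℝ≥0 → (Op n →CP Op n)
  unital : ∀ t, map t 1 = 1
  map_zero : ∀ f, map 0 f = f
  map_add : ∀ s t f, map (s + t) f = map s (map t f)
  strong_cont : ∀ f, Filter.Tendsto (fun t => ‖map t f - f‖) (𝓝 0) (𝓝 0)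

namespace QuantumMarkovSemigroup

variable {n : Type*} [Fintype n] [DecidableEq n]

/-- `𝓛 f = lim_{t ↓ 0} (Λ_t f - f) / t` for all `f`. -/
def HasGenerator (Λ : QuantumMarkovSemigroup n) (𝓛 : SuperOp n) : Prop :=
  ∀ f : Op n, Filter.Tendsto (fun t : ℝ≥0 => ((t : ℝ)⁻¹ : ℝ) • (Λ.map t f - f)) (𝓝[≠] 0) (𝓝 (𝓛 f))

/-- `Tr (ρ Λ_t(f)) = Tr (ρ f)` for all `f` and `t`. -/
def IsInvariant (Λ : QuantumMarkovSemigroup n) (ρ : Op n) : Prop :=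
  ∀ (t : ℝ≥0) (f : Op n), (ρ * Λ.map t f).trace = (ρ * f).trace

/-- The semigroup is primitive: the full-rank state `σ` is its unique invariant state. -/
def IsPrimitive (Λ : QuantumMarkovSemigroup n) (σ : Op n) : Prop :=
  IsFullRankState σ ∧ Λ.IsInvariant σ ∧ ∀ ρ : Op n, IsState ρ → Λ.IsInvariant ρ → ρ = σ

end QuantumMarkovSemigroup

/-- The parameters of a generator in detailed-balance form: weights `c_j`, Bohr frequencies
`ω_j` and operators `L̃_j`. -/
structure LindbladData (n J : Type*) where
  /-- The weights `c_j`. -/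
  c : J → ℝ
  /-- The frequencies `ω_j`. -/
  freq : J → ℝ
  /-- The operators `L̃_j`. -/
  L : J → Op n

namespace LindbladData

variable {n J : Type*} [Fintype n] [DecidableEq n] [Fintype J] [DecidableEq J]

/-- The conditions on the parameters of the detailed-balance form with respect to `σ`. -/
structure IsDetailedBalance (S : LindbladData n J) (σ : Op n) : Prop where
  c_pos : ∀ j, 0 < S.c j
  adjoint_closed : Set.range S.L = Set.range (fun j => (S.L j)ᴴ)
  eigenvector : ∀ j, modularOp σ (S.L j) = (Real.exp (-S.freq j) : ℂ) • S.L j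
  orthonormal : ∀ j k,
    (1 / (Fintype.card n : ℂ)) * ((S.L j)ᴴ * S.L k).trace = if k = j then 1 else 0
  traceless : ∀ j, (S.L j).trace = 0
  c_symm : ∀ j j', (S.L j)ᴴ = S.L j' → S.c j = S.c j'

/-- The commutator with `A` on the left, `f ↦ [A, f]`. -/
def comm (A : Op n) : SuperOp n := LinearMap.mulLeft ℂ A - LinearMap.mulRight ℂ A

/-- The generator
`𝓛 f = ∑_j c_j (e^{-ω_j/2} L̃_j* [f, L̃_j] + e^{ω_j/2} [L̃_j, f] L̃_j*)`. -/
def generator (S : LindbladData n J) : SuperOp n :=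
  ∑ j, (S.c j : ℂ) •
    ((Real.exp (-S.freq j / 2) : ℂ) • (LinearMap.mulLeft ℂ (S.L j)ᴴ ∘ₗ (-comm (S.L j)))
      + (Real.exp (S.freq j / 2) : ℂ) • (LinearMap.mulRight ℂ (S.L j)ᴴ ∘ₗ comm (S.L j)))

/-- The gradient `∇U = (∂_j U)_j`, `∂_j U = [L̃_j, U]`. -/
def grad (S : LindbladData n J) (U : Op n) : J → Op n := fun j => comm (S.L j) U

/-- The divergence `div A = ∑_j c_j [A_j, L̃_j*]`. -/
def div (S : LindbladData n J) (A : J → Op n) : Op n :=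
  ∑ j, (S.c j : ℂ) • comm (A j) (S.L j)ᴴ

/-- `([ρ]_{ω_j} A_j)_j`. -/
def bracketVec (S : LindbladData n J) (ρ : Op n) (A : J → Op n) : J → Op n :=
  fun j => bracketOp ρ (S.freq j) (A j)

/-- `‖V‖²_{𝓛,ρ} = ∑_j c_j ⟨V_j, [ρ]_{ω_j} V_j⟩_HS`. -/
def normSq (S : LindbladData n J) (ρ : Op n) (V : J → Op n) : ℝ :=
  (∑ j, (S.c j : ℂ) * ((V j)ᴴ * S.bracketVec ρ V j).trace).re

/-- `γ : [0,1] → D₊(H)` is a smooth path from `ρ` to `σ`, and the field `V(s) = ∇U(s)`, with `U(s)`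
self-adjoint and traceless, solves the continuity equation `γ'(s) = - div ([γ(s)] ∇U(s))`. -/
structure IsTransportPath (S : LindbladData n J) (ρ σ : Op n) (γ U : ℝ → Op n) : Prop where
  smooth : ContDiffOn ℝ ∞ γ (Set.Icc 0 1)
  state : ∀ s ∈ Set.Icc (0 : ℝ) 1, IsFullRankState (γ s)
  source : γ 0 = ρ
  target : γ 1 = σ
  potential : ∀ s ∈ Set.Icc (0 : ℝ) 1, (U s).IsHermitian ∧ (U s).trace = 0
  continuity : ∀ s ∈ Set.Icc (0 : ℝ) 1,
    HasDerivWithinAt γ (-S.div (S.bracketVec (γ s) (S.grad (U s)))) (Set.Icc 0 1) s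

/-- The modified non-commutative Wasserstein distance of order 2,
`W_{2,𝓛}(ρ,σ) = inf (∫₀¹ ‖V(s)‖²_{𝓛,γ(s)} ds)^{1/2}`. -/
def W₂ (S : LindbladData n J) (ρ σ : Op n) : ℝ≥0∞ :=
  ⨅ (γ : ℝ → Op n) (U : ℝ → Op n) (_ : S.IsTransportPath ρ σ γ U),
    (∫⁻ s in Set.Icc (0 : ℝ) 1, ENNReal.ofReal (S.normSq (γ s) (S.grad (U s)))) ^ (1 / 2 : ℝ)

/-- TC₂(c₂): `W_{2,𝓛}(ρ,σ) ≤ √(2 c₂ D(ρ‖σ))` for all full-rank states `ρ`. -/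
def TransportCost₂ (S : LindbladData n J) (σ : Op n) (c₂ : ℝ) : Prop :=
  ∀ ρ : Op n, IsFullRankState ρ →
    S.W₂ ρ σ ≤ ENNReal.ofReal (Real.sqrt (2 * c₂ * relEntropy ρ σ))

/-- `κ_𝓛 = sup_j ‖[σ]_{ω_j} ∘ [σ]_{-ω_j}⁻¹‖_{∞→∞}`. -/
def κ (S : LindbladData n J) (σ : Op n) : ℝ :=
  ⨆ j, superNorm (bracketOp σ (S.freq j) ∘ₗ Ring.inverse (bracketOp σ (-S.freq j)))

end LindbladData

section Poincare

variable {n : Type*} [Fintype n] [DecidableEq n]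

/-- The 2-Dirichlet form `E_{φ,2}(f,g) = -⟨f, 𝓛 g⟩_{φ,σ}`. -/
def dirichletForm (φ : ℝ → ℝ) (σ : Op n) (𝓛 : SuperOp n) (f g : Op n) : ℂ :=
  -innerφ φ σ f (𝓛 g)

/-- PI(l): `l ‖f‖²_{φ,σ} ≤ E_{φ,2}(f,f)` for all `f ∈ B(H)` with `Tr (σ f) = 0`. -/
def PoincareInequality (φ : ℝ → ℝ) (σ : Op n) (𝓛 : SuperOp n) (l : ℝ) : Prop :=
  ∀ f : Op n, (σ * f).trace = 0 →
    l * (innerφ φ σ f f).re ≤ (dirichletForm φ σ 𝓛 f f).re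

end Poincare

end QMS

end

/-! The transport inequality is linearised at `σ`. For self-adjoint `g` with `Tr (σ g) = 0`,
consider the Gibbs states `ρ_e = exp (log σ + e g) / Z_e`. If `v` is the Kubo–Mori variance of `g`,
then `Tr (g ρ_e) = e v + o(e)` and `D(ρ_e‖σ) = e² v / 2 + o(e²)` (`hasDerivAt_reTrace_exp_log`,
`relEntropy_gibbs`).

Conversely, integration by parts and Cauchy–Schwarz along a transport path bound `|Tr (g (σ - ρ))|`
by the square root of the largest `‖∇g‖²` on the path times the length bound. A path of small energy
stays near `σ`, hence below `(1 + δ) σ`. The weighted norm is monotone in the state by Löwner–Heinz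
(`specForm_bracket_mono`), so `‖∇g‖²` along the path is at most `1 + δ` times its value at `σ`
(`exists_abs_reTrace_le`). Dividing by `e` and letting `e → 0`, then `δ → 0`, gives `v² ≤ ‖∇g‖²_σ c₂
v`, that is, a Poincaré inequality for the Kubo–Mori product with constant `1 / c₂`
(`kuboMori_le_of_transportCost`).

The passage to the symmetric product loses nothing. Put `g = h(Δ_σ) f` with `h² f_0 = t^{1/2}`. Then
`v = ⟨f, f⟩_{1/2,σ}`. Since `∂_j φ(Δ_σ) = φ(e^{ω_j} Δ_σ) ∂_j` and `f_ω(t) = e^{-ω/2} f_0(e^ω t)`,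
also `‖∇g‖²_σ` equals the Dirichlet form of `f` (`energyForm_halfRatio`). As `h(1/t) = h(t)`,
self-adjointness is preserved; general `f` follows by splitting into self-adjoint parts.

This proves the inequality with constant `1 / c₂`. The stated constant follows from `κ ≥ 1`
(`LindbladData.one_le_κ`), because `[σ]_ω ∘ [σ]_{-ω}⁻¹` fixes `σ`. -/

namespace QMS

/-! ### Spectral blocks and weighted sesquilinear forms. -/

section SpectralForm

variable {n : Type*} [Fintype n] [DecidableEq n]

/-- The spectrum is finite, so every function, including the indicators defining `specProj`, is
admissible in the functional calculus. -/
lemma continuousOn_spectrum (f : ℝ → ℝ) (ρ : Op n) : ContinuousOn f (spectrum ℝ ρ) :=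
  (Matrix.finite_real_spectrum (A := ρ)).continuousOn f

lemma mem_specFinset {ρ : Op n} {x : ℝ} : x ∈ specFinset ρ ↔ x ∈ spectrum ℝ ρ := by
  simp [specFinset]

lemma cfc_eq_sum_specProj (f : ℝ → ℝ) {ρ : Op n} (hρ : ρ.IsHermitian) :
    cfc f ρ = ∑ x ∈ specFinset ρ, (f x : ℂ) • specProj ρ x := by
  have hsa : IsSelfAdjoint ρ := hρ
  have h1 : ∀ x : ℝ, (f x : ℂ) • specProj ρ x
      = cfc (fun t : ℝ => f x * (if t = x then (1 : ℝ) else 0)) ρ := by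
    intro x
    rw [cfc_const_mul _ _ _ (continuousOn_spectrum _ _), specProj]
    exact Complex.coe_smul _ _
  simp_rw [h1]
  rw [← cfc_sum _ _ _ (fun i _ => continuousOn_spectrum _ _)]
  refine cfc_congr fun t ht => ?_
  rw [Finset.sum_apply]
  simp [mem_specFinset, ht]

lemma specProj_mul_specProj (ρ : Op n) (x y : ℝ) :
    specProj ρ x * specProj ρ y = if x = y then specProj ρ x else 0 := by
  unfold specProj
  rw [← cfc_mul _ _ _ (continuousOn_spectrum _ _) (continuousOn_spectrum _ _)]
  split_ifs with h
  · subst h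
    exact cfc_congr fun t _ => by simp
  · rw [← cfc_zero ℝ ρ]
    refine cfc_congr fun t _ => ?_
    by_cases h1 : t = x
    · subst h1; simp [h]
    · simp [h1]

lemma conjTranspose_specProj (ρ : Op n) (x : ℝ) : (specProj ρ x)ᴴ = specProj ρ x :=
  (cfc_predicate _ ρ : IsSelfAdjoint (specProj ρ x))

lemma sum_specProj {ρ : Op n} (hρ : ρ.IsHermitian) : ∑ x ∈ specFinset ρ, specProj ρ x = 1 := by
  have h := cfc_eq_sum_specProj (fun _ => 1) hρ
  rw [cfc_const_one ℝ ρ (show IsSelfAdjoint ρ from hρ)] at h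
  simpa using h.symm

lemma specProj_mul_cfc (f : ℝ → ℝ) {ρ : Op n} (hρ : ρ.IsHermitian) {x : ℝ}
    (hx : x ∈ specFinset ρ) : specProj ρ x * cfc f ρ = (f x : ℂ) • specProj ρ x := by
  rw [cfc_eq_sum_specProj f hρ, Finset.mul_sum]
  simp [specProj_mul_specProj, hx]

lemma cfc_mul_specProj (f : ℝ → ℝ) {ρ : Op n} (hρ : ρ.IsHermitian) {x : ℝ}
    (hx : x ∈ specFinset ρ) : cfc f ρ * specProj ρ x = (f x : ℂ) • specProj ρ x := by
  rw [cfc_eq_sum_specProj f hρ, Finset.sum_mul]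
  simp [specProj_mul_specProj, hx]

lemma specProj_mul_self {ρ : Op n} (hρ : ρ.IsHermitian) {x : ℝ}
    (hx : x ∈ specFinset ρ) : specProj ρ x * ρ = (x : ℂ) • specProj ρ x := by
  have := specProj_mul_cfc (fun x => x) hρ hx
  rwa [cfc_id' ℝ ρ (show IsSelfAdjoint ρ from hρ)] at this

lemma self_mul_specProj {ρ : Op n} (hρ : ρ.IsHermitian) {x : ℝ}
    (hx : x ∈ specFinset ρ) : ρ * specProj ρ x = (x : ℂ) • specProj ρ x := by
  have := cfc_mul_specProj (fun x => x) hρ hx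
  rwa [cfc_id' ℝ ρ (show IsSelfAdjoint ρ from hρ)] at this

lemma pos_of_mem_specFinset {ρ : Op n} (hρ : ρ.PosDef) {x : ℝ} (hx : x ∈ specFinset ρ) :
    0 < x := by
  rw [mem_specFinset, hρ.1.spectrum_real_eq_range_eigenvalues] at hx
  obtain ⟨i, rfl⟩ := hx
  exact hρ.eigenvalues_pos i

lemma le_one_of_mem_specFinset {ρ : Op n} (hρ : IsFullRankState ρ) {x : ℝ}
    (hx : x ∈ specFinset ρ) : x ≤ 1 := by
  rw [mem_specFinset, hρ.1.1.spectrum_real_eq_range_eigenvalues] at hx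
  obtain ⟨i, rfl⟩ := hx
  have h : (1 : ℂ) = _ := hρ.2.symm.trans hρ.1.1.trace_eq_sum_eigenvalues
  have h' : (1 : ℝ) = ∑ i, hρ.1.1.eigenvalues i := by
    apply Complex.ofReal_injective
    push_cast
    exact h
  rw [h']
  exact Finset.single_le_sum (f := hρ.1.1.eigenvalues)
    (fun j _ => (hρ.1.eigenvalues_pos j).le) (Finset.mem_univ i)

lemma modularFun_apply (φ : ℝ → ℝ) (ρ A : Op n) :
    modularFun φ ρ A = ∑ x ∈ specFinset ρ, ∑ y ∈ specFinset ρ,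
      (φ (x / y) : ℂ) • (specProj ρ x * A * specProj ρ y) := by
  simp [modularFun, LinearMap.sum_apply, mul_assoc]

lemma specProj_modularFun (φ : ℝ → ℝ) (ρ A : Op n) {x y : ℝ}
    (hx : x ∈ specFinset ρ) (hy : y ∈ specFinset ρ) :
    specProj ρ x * modularFun φ ρ A * specProj ρ y
      = (φ (x / y) : ℂ) • (specProj ρ x * A * specProj ρ y) := by
  rw [modularFun_apply, Finset.mul_sum, Finset.sum_mul]
  simp_rw [Finset.mul_sum, Finset.sum_mul]
  rw [Finset.sum_eq_single_of_mem x hx, Finset.sum_eq_single_of_mem y hy]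
  · have hxx := specProj_mul_specProj ρ x x
    have hyy := specProj_mul_specProj ρ y y
    simp only [if_true] at hxx hyy
    rw [mul_smul_comm, smul_mul_assoc]
    congr 1
    calc specProj ρ x * (specProj ρ x * A * specProj ρ y) * specProj ρ y
        = (specProj ρ x * specProj ρ x) * A * (specProj ρ y * specProj ρ y) := by noncomm_ring
      _ = _ := by rw [hxx, hyy]
  · intro z _ hz
    have : specProj ρ z * specProj ρ y = 0 := by rw [specProj_mul_specProj, if_neg hz]
    rw [mul_smul_comm, smul_mul_assoc, mul_assoc, mul_assoc (specProj ρ x * A), this]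
    simp
  · intro z _ hz
    have : specProj ρ x * specProj ρ z = 0 := by rw [specProj_mul_specProj, if_neg hz.symm]
    refine Finset.sum_eq_zero fun w _ => ?_
    rw [mul_smul_comm, smul_mul_assoc, ← mul_assoc, ← mul_assoc, this]
    simp

/-- Two operators with the same spectral blocks are equal. -/
lemma ext_specProj {ρ : Op n} (hρ : ρ.IsHermitian) {A B : Op n}
    (h : ∀ x ∈ specFinset ρ, ∀ y ∈ specFinset ρ,
      specProj ρ x * A * specProj ρ y = specProj ρ x * B * specProj ρ y) : A = B := by
  have key : ∀ C : Op n, C = ∑ x ∈ specFinset ρ, ∑ y ∈ specFinset ρ,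
      specProj ρ x * C * specProj ρ y := by
    intro C
    simp_rw [← Finset.mul_sum, ← Finset.sum_mul, sum_specProj hρ]
    simp
  rw [key A, key B]
  exact Finset.sum_congr rfl fun x hx => Finset.sum_congr rfl fun y hy => h x hx y hy

lemma modularFun_modularFun (φ ψ : ℝ → ℝ) {ρ : Op n} (hρ : ρ.IsHermitian) (A : Op n) :
    modularFun φ ρ (modularFun ψ ρ A) = modularFun (fun t => φ t * ψ t) ρ A := by
  refine ext_specProj hρ fun x hx y hy => ?_
  rw [specProj_modularFun _ _ _ hx hy, specProj_modularFun _ _ _ hx hy,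
    specProj_modularFun _ _ _ hx hy, smul_smul]
  push_cast
  rfl

lemma modularFun_const_smul (c : ℝ) (φ : ℝ → ℝ) (ρ A : Op n) :
    modularFun (fun t => c * φ t) ρ A = (c : ℂ) • modularFun φ ρ A := by
  simp only [modularFun_apply, Finset.smul_sum, smul_smul]
  push_cast
  rfl

/-- The sesquilinear form `∑_{x,y} w(x,y) Tr (A* P_x(ρ) B P_y(ρ))`. -/
noncomputable def specForm (w : ℝ → ℝ → ℝ) (ρ A B : Op n) : ℂ :=
  ∑ x ∈ specFinset ρ, ∑ y ∈ specFinset ρ,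
    (w x y : ℂ) * (Aᴴ * specProj ρ x * B * specProj ρ y).trace

lemma trace_weightedOp (φ : ℝ → ℝ) {ρ : Op n} (hρ : ρ.IsHermitian) (A B : Op n) :
    (Aᴴ * weightedOp φ ρ B).trace = specForm (fun x y => y * φ (x / y)) ρ A B := by
  have h : weightedOp φ ρ B = modularFun φ ρ B * ρ := rfl
  rw [h, modularFun_apply, specForm, Finset.sum_mul, Finset.mul_sum, Matrix.trace_sum]
  refine Finset.sum_congr rfl fun x hx => ?_
  rw [Finset.sum_mul, Finset.mul_sum, Matrix.trace_sum]
  refine Finset.sum_congr rfl fun y hy => ?_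
  rw [smul_mul_assoc, mul_assoc _ _ ρ, specProj_mul_self hρ hy, mul_smul_comm, mul_smul_comm,
    mul_smul_comm, Matrix.trace_smul, Matrix.trace_smul]
  simp only [smul_eq_mul, ← mul_assoc]
  push_cast
  ring

/-- Idempotence and cyclicity exhibit each block as a Hilbert–Schmidt product; hence a form with
nonnegative weights is positive, and comparing forms reduces to comparing weights. -/
lemma trace_conjTranspose_specProj (ρ A B : Op n) (x y : ℝ) :
    (Aᴴ * specProj ρ x * B * specProj ρ y).trace
      = ((specProj ρ x * A * specProj ρ y)ᴴ * (specProj ρ x * B * specProj ρ y)).trace := by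
  have hxx := specProj_mul_specProj ρ x x
  have hyy := specProj_mul_specProj ρ y y
  simp only [if_true] at hxx hyy
  rw [Matrix.conjTranspose_mul, Matrix.conjTranspose_mul, conjTranspose_specProj,
    conjTranspose_specProj]
  calc (Aᴴ * specProj ρ x * B * specProj ρ y).trace
      = (Aᴴ * (specProj ρ x * specProj ρ x) * B * (specProj ρ y * specProj ρ y)).trace := by
        rw [hxx, hyy]
    _ = ((Aᴴ * (specProj ρ x * specProj ρ x) * B * specProj ρ y) * specProj ρ y).trace := by
        simp only [mul_assoc]
    _ = _ := by rw [Matrix.trace_mul_comm]; simp only [mul_assoc]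

lemma trace_conj_specProj_nonneg (ρ A : Op n) (x y : ℝ) :
    0 ≤ (Aᴴ * specProj ρ x * A * specProj ρ y).trace.re := by
  rw [trace_conjTranspose_specProj]
  exact (Complex.le_def.1
    (Matrix.posSemidef_conjTranspose_mul_self (specProj ρ x * A * specProj ρ y)).trace_nonneg).1

lemma specForm_self_re (w : ℝ → ℝ → ℝ) (ρ A : Op n) :
    (specForm w ρ A A).re = ∑ x ∈ specFinset ρ, ∑ y ∈ specFinset ρ,
      w x y * (Aᴴ * specProj ρ x * A * specProj ρ y).trace.re := by
  simp [specForm, Complex.re_sum]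

lemma specForm_self_mono {w w' : ℝ → ℝ → ℝ} {ρ : Op n} (A : Op n)
    (h : ∀ x ∈ specFinset ρ, ∀ y ∈ specFinset ρ, w x y ≤ w' x y) :
    (specForm w ρ A A).re ≤ (specForm w' ρ A A).re := by
  simp only [specForm_self_re]
  exact Finset.sum_le_sum fun x hx => Finset.sum_le_sum fun y hy =>
    mul_le_mul_of_nonneg_right (h x hx y hy) (trace_conj_specProj_nonneg ρ A x y)

lemma specForm_congr {w w' : ℝ → ℝ → ℝ} {ρ : Op n} (A B : Op n)
    (h : ∀ x ∈ specFinset ρ, ∀ y ∈ specFinset ρ, w x y = w' x y) :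
    specForm w ρ A B = specForm w' ρ A B := by
  unfold specForm
  exact Finset.sum_congr rfl fun x hx => Finset.sum_congr rfl fun y hy => by rw [h x hx y hy]

lemma specForm_self_nonneg {w : ℝ → ℝ → ℝ} {ρ : Op n} (A : Op n)
    (h : ∀ x ∈ specFinset ρ, ∀ y ∈ specFinset ρ, 0 ≤ w x y) :
    0 ≤ (specForm w ρ A A).re := by
  rw [specForm_self_re]
  exact Finset.sum_nonneg fun x hx => Finset.sum_nonneg fun y hy =>
    mul_nonneg (h x hx y hy) (trace_conj_specProj_nonneg ρ A x y)

lemma specForm_conj_symm (w : ℝ → ℝ → ℝ) (ρ A B : Op n) :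
    (specForm w ρ A B).re = (specForm w ρ B A).re := by
  simp only [specForm, Complex.re_sum, Complex.re_ofReal_mul]
  refine Finset.sum_congr rfl fun x _ => Finset.sum_congr rfl fun y _ => ?_
  congr 1
  have h : (Aᴴ * specProj ρ x * B * specProj ρ y).trace
      = star (Bᴴ * specProj ρ x * A * specProj ρ y).trace := by
    rw [← Matrix.trace_conjTranspose]
    simp only [Matrix.conjTranspose_mul, Matrix.conjTranspose_conjTranspose,
      conjTranspose_specProj]
    rw [Matrix.trace_mul_comm]
    simp only [mul_assoc]
  rw [h]
  simp

lemma specForm_add_left (w : ℝ → ℝ → ℝ) (ρ A A' B : Op n) :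
    specForm w ρ (A + A') B = specForm w ρ A B + specForm w ρ A' B := by
  simp only [specForm, ← Finset.sum_add_distrib, Matrix.conjTranspose_add, add_mul,
    Matrix.trace_add, mul_add]

lemma specForm_add_right (w : ℝ → ℝ → ℝ) (ρ A B B' : Op n) :
    specForm w ρ A (B + B') = specForm w ρ A B + specForm w ρ A B' := by
  simp only [specForm, ← Finset.sum_add_distrib, mul_add, add_mul, Matrix.trace_add]

lemma specForm_smul_right (w : ℝ → ℝ → ℝ) (ρ A B : Op n) (c : ℂ) :
    specForm w ρ A (c • B) = c * specForm w ρ A B := by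
  simp only [specForm, Finset.mul_sum, mul_smul_comm, smul_mul_assoc, Matrix.trace_smul,
    smul_eq_mul]
  refine Finset.sum_congr rfl fun x _ => Finset.sum_congr rfl fun y _ => ?_
  ring

lemma specForm_smul_left (w : ℝ → ℝ → ℝ) (ρ A B : Op n) (c : ℂ) :
    specForm w ρ (c • A) B = star c * specForm w ρ A B := by
  simp only [specForm, Finset.mul_sum, Matrix.conjTranspose_smul, smul_mul_assoc,
    Matrix.trace_smul, smul_eq_mul]
  refine Finset.sum_congr rfl fun x _ => Finset.sum_congr rfl fun y _ => ?_
  ring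

lemma specForm_mul (f g : ℝ → ℝ) {ρ : Op n} (hρ : ρ.IsHermitian) (A B : Op n) :
    specForm (fun x y => f x * g y) ρ A B = (Aᴴ * cfc f ρ * B * cfc g ρ).trace := by
  rw [cfc_eq_sum_specProj f hρ, cfc_eq_sum_specProj g hρ, specForm]
  simp only [Finset.mul_sum, Finset.sum_mul, Matrix.trace_sum, mul_smul_comm, smul_mul_assoc,
    Matrix.trace_smul, smul_eq_mul]
  rw [Finset.sum_comm]
  refine Finset.sum_congr rfl fun x _ => Finset.sum_congr rfl fun y _ => ?_
  push_cast
  ring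

end SpectralForm

end QMS

namespace QMS

/-! ### The scalar weight of `[ρ]_w`. -/

section FrequencyWeight

/-- The weight is the logarithmic mean of `e^{w/2} x` and `e^{-w/2} y`, the integral of their
weighted geometric means. Positivity, bounds, symmetry and operator monotonicity are all read off
from this formula. -/
lemma integral_weight (w : ℝ) {x y : ℝ} (hx : 0 < x) (hy : 0 < y) :
    ∫ s in (0 : ℝ)..1, Real.exp (w * (1 / 2 - s)) * (x ^ (1 - s) * y ^ s)
      = y * fFreq w (x / y) := by
  have h1 : ∀ s : ℝ, Real.exp (w * (1 / 2 - s)) * (x ^ (1 - s) * y ^ s)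
      = Real.exp (w / 2) * x * Real.exp ((Real.log y - Real.log x - w) * s) := by
    intro s
    rw [Real.rpow_def_of_pos hx, Real.rpow_def_of_pos hy]
    conv_rhs => rw [← Real.exp_log hx]
    rw [Real.log_exp]
    simp only [← Real.exp_add]
    congr 1
    ring
  simp_rw [h1]
  rw [intervalIntegral.integral_const_mul]
  have hxy : 0 < x / y := div_pos hx hy
  have hlog : Real.log (x / y) = Real.log x - Real.log y := Real.log_div hx.ne' hy.ne'
  by_cases hb : Real.log y - Real.log x - w = 0
  · have ht : x / y = Real.exp (-w) := by
      rw [← Real.exp_log hxy, hlog]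
      congr 1
      linarith
    have hx' : x = Real.exp (-w) * y := by rw [← ht]; field_simp
    rw [fFreq, if_pos ht, hb]
    simp only [zero_mul, Real.exp_zero, intervalIntegral.integral_const, sub_zero, smul_eq_mul,
      mul_one]
    rw [hx', ← mul_assoc, ← Real.exp_add, mul_comm]
    congr 2
    ring
  · have ht : x / y ≠ Real.exp (-w) := by
      intro h
      apply hb
      have := congrArg Real.log h
      rw [Real.log_exp, hlog] at this
      linarith
    rw [fFreq, if_neg ht, intervalIntegral.integral_comp_mul_left (fun u => Real.exp u) hb,
      integral_exp, hlog]
    have hb' : Real.log x - Real.log y + w ≠ 0 := fun h => hb (by linarith)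
    have e1 : Real.exp (Real.log y - Real.log x - w) = y / x * Real.exp (-w) := by
      rw [show Real.log y - Real.log x - w = Real.log y + -Real.log x + -w by ring,
        Real.exp_add, Real.exp_add, Real.exp_neg (Real.log x), Real.exp_log hx, Real.exp_log hy,
        div_eq_mul_inv]
    rw [mul_one, mul_zero, Real.exp_zero, e1, smul_eq_mul]
    have hb2 : (Real.log y - Real.log x - w)⁻¹ = -(Real.log x - Real.log y + w)⁻¹ := by
      rw [← inv_neg]; congr 1; ring
    rw [hb2]
    field_simp
    ring

lemma continuous_weight (w : ℝ) {x y : ℝ} (hx : 0 < x) (hy : 0 < y) :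
    Continuous fun s : ℝ => Real.exp (w * (1 / 2 - s)) * (x ^ (1 - s) * y ^ s) := by
  refine Continuous.mul (by fun_prop) (Continuous.mul ?_ ?_)
  · exact Continuous.rpow continuous_const (by fun_prop) fun _ => Or.inl hx.ne'
  · exact Continuous.rpow continuous_const (by fun_prop) fun _ => Or.inl hy.ne'

lemma weight_pos (w : ℝ) {x y : ℝ} (hx : 0 < x) (hy : 0 < y) : 0 < y * fFreq w (x / y) := by
  rw [← integral_weight w hx hy]
  refine intervalIntegral.intervalIntegral_pos_of_pos
    ((continuous_weight w hx hy).intervalIntegrable _ _) (fun s => ?_) one_pos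
  have := Real.rpow_pos_of_pos hx (1 - s)
  have := Real.rpow_pos_of_pos hy s
  positivity

lemma fFreq_pos (w : ℝ) {t : ℝ} (ht : 0 < t) : 0 < fFreq w t := by
  have := weight_pos w ht one_pos
  simpa using this

/-- The bound does not degenerate as eigenvalues approach `0`, although `fFreq w` alone is
unbounded. This gives estimates uniform over all full-rank states. -/
lemma weight_le (w : ℝ) {x y : ℝ} (hx : 0 < x) (hy : 0 < y) (hx1 : x ≤ 1) (hy1 : y ≤ 1) :
    y * fFreq w (x / y) ≤ Real.exp (|w| / 2) := by
  rw [← integral_weight w hx hy]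
  have h := intervalIntegral.integral_mono_on (zero_le_one (α := ℝ))
    ((continuous_weight w hx hy).intervalIntegrable _ _)
    ((continuous_const (y := Real.exp (|w| / 2))).intervalIntegrable (μ := volume) _ _)
    (fun s hs => ?_)
  · simpa using h
  · have h1 : x ^ (1 - s) ≤ 1 := Real.rpow_le_one hx.le hx1 (by linarith [hs.2])
    have h2 : y ^ s ≤ 1 := Real.rpow_le_one hy.le hy1 hs.1
    have h3 : x ^ (1 - s) * y ^ s ≤ 1 :=
      mul_le_one₀ h1 (Real.rpow_pos_of_pos hy s).le h2
    have h4 : w * (1 / 2 - s) ≤ |w| / 2 := by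
      have h5 : |1 / 2 - s| ≤ 1 / 2 := by rw [abs_le]; constructor <;> linarith [hs.1, hs.2]
      calc w * (1 / 2 - s) ≤ |w * (1 / 2 - s)| := le_abs_self _
        _ = |w| * |1 / 2 - s| := abs_mul _ _
        _ ≤ |w| * (1 / 2) := mul_le_mul_of_nonneg_left h5 (abs_nonneg w)
        _ = |w| / 2 := by ring
    calc Real.exp (w * (1 / 2 - s)) * (x ^ (1 - s) * y ^ s)
        ≤ Real.exp (w * (1 / 2 - s)) * 1 := mul_le_mul_of_nonneg_left h3 (Real.exp_pos _).le
      _ ≤ Real.exp (|w| / 2) := by rw [mul_one]; exact Real.exp_le_exp.2 h4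

/-- `f_w(t) = e^{-w/2} f_0(e^w t)`. -/
lemma fFreq_eq_fFreq_zero (w : ℝ) {t : ℝ} (ht : 0 < t) :
    fFreq w t = Real.exp (-w / 2) * fFreq 0 (Real.exp w * t) := by
  unfold fFreq
  have h : (Real.exp w * t = Real.exp (-0)) ↔ t = Real.exp (-w) := by
    rw [neg_zero, Real.exp_zero, Real.exp_neg, mul_comm]
    exact ⟨eq_inv_of_mul_eq_one_left, fun h => by rw [h, inv_mul_cancel₀ (Real.exp_pos w).ne']⟩
  by_cases h1 : t = Real.exp (-w)
  · rw [if_pos h1, if_pos (h.2 h1)]; simp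
  · rw [if_neg h1, if_neg (mt h.1 h1), Real.log_mul (Real.exp_pos w).ne' ht.ne', Real.log_exp]
    simp only [neg_zero, zero_div, Real.exp_zero, one_mul, add_zero]
    rw [show w + Real.log t = Real.log t + w by ring, ← mul_div_assoc]
    congr 1
    rw [show Real.exp (w / 2) = Real.exp (-w / 2) * Real.exp w by
      rw [← Real.exp_add]; congr 1; ring, mul_assoc, mul_sub, ← Real.exp_add]
    simp

lemma fFreq_one_neg (w : ℝ) : fFreq (-w) 1 = fFreq w 1 := by
  have h1 := integral_weight w one_pos one_pos
  have h2 := integral_weight (-w) one_pos one_pos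
  simp only [Real.one_rpow, mul_one, one_mul, div_one] at h1 h2
  rw [← h1, ← h2]
  have h3 := intervalIntegral.integral_comp_sub_left
    (fun s : ℝ => Real.exp (w * (1 / 2 - s))) (1 : ℝ) (a := 0) (b := 1)
  simp only [sub_self, sub_zero] at h3
  rw [← h3]
  congr 1
  ext s
  congr 1
  ring

/-- The substitution `s ↦ 1 - s` exchanges `x` and `y` in the logarithmic mean. -/
lemma weight_zero_symm {x y : ℝ} (hx : 0 < x) (hy : 0 < y) :
    y * fFreq 0 (x / y) = x * fFreq 0 (y / x) := by
  rw [← integral_weight 0 hx hy, ← integral_weight 0 hy hx]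
  have h3 := intervalIntegral.integral_comp_sub_left
    (fun s : ℝ => Real.exp (0 * (1 / 2 - s)) * (x ^ (1 - s) * y ^ s)) (1 : ℝ) (a := 0) (b := 1)
  simp only [sub_self, sub_zero] at h3
  rw [← h3]
  congr 1
  ext s
  rw [show (1 : ℝ) - (1 - s) = s by ring]
  simp
  ring

end FrequencyWeight

/-! ### Monotonicity of the weighted norm in the state. -/

section Monotonicity

variable {n : Type*} [Fintype n] [DecidableEq n]

lemma trace_cfc_rpow_eq_sum (w : ℝ) {ρ : Op n} (hρ : ρ.IsHermitian) (A : Op n) (s : ℝ) :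
    Real.exp (w * (1 / 2 - s)) *
        (Aᴴ * cfc (fun x : ℝ => x ^ (1 - s)) ρ * A * cfc (fun x : ℝ => x ^ s) ρ).trace.re
      = ∑ x ∈ specFinset ρ, ∑ y ∈ specFinset ρ,
        (Real.exp (w * (1 / 2 - s)) * (x ^ (1 - s) * y ^ s)) *
          (Aᴴ * specProj ρ x * A * specProj ρ y).trace.re := by
  rw [← specForm_mul _ _ hρ, specForm_self_re, Finset.mul_sum]
  simp_rw [Finset.mul_sum, mul_assoc]

lemma specForm_bracket_eq_integral (w : ℝ) {ρ : Op n} (hρ : ρ.PosDef) (A : Op n) :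
    (specForm (fun x y => y * fFreq w (x / y)) ρ A A).re
      = ∫ s in (0 : ℝ)..1, Real.exp (w * (1 / 2 - s)) *
          (Aᴴ * cfc (fun x : ℝ => x ^ (1 - s)) ρ * A * cfc (fun x : ℝ => x ^ s) ρ).trace.re := by
  simp_rw [trace_cfc_rpow_eq_sum w hρ.1]
  rw [intervalIntegral.integral_finsetSum, specForm_self_re]
  · refine Finset.sum_congr rfl fun x hx => ?_
    rw [intervalIntegral.integral_finsetSum]
    · refine Finset.sum_congr rfl fun y hy => ?_
      rw [intervalIntegral.integral_mul_const,
        integral_weight w (pos_of_mem_specFinset hρ hx) (pos_of_mem_specFinset hρ hy)]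
    · exact fun y hy => ((continuous_weight w (pos_of_mem_specFinset hρ hx)
        (pos_of_mem_specFinset hρ hy)).mul continuous_const).intervalIntegrable _ _
  · exact fun x hx => (continuous_finsetSum _ fun y hy =>
      (continuous_weight w (pos_of_mem_specFinset hρ hx)
        (pos_of_mem_specFinset hρ hy)).mul continuous_const).intervalIntegrable _ _

lemma trace_mul_re_nonneg {A B : Op n} (hA : A.PosSemidef) (hB : B.PosSemidef) :
    0 ≤ (A * B).trace.re := by
  obtain ⟨C, rfl⟩ := CStarAlgebra.nonneg_iff_eq_star_mul_self.1
    (Matrix.nonneg_iff_posSemidef.2 hA)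
  rw [mul_assoc, Matrix.trace_mul_comm]
  exact (Complex.le_def.1 (hB.mul_mul_conjTranspose_same C).trace_nonneg).1

lemma trace_sandwich_mono (A : Op n) {P P' Q Q' : Op n} (hP : P ≤ P') (hQ : Q ≤ Q')
    (hP' : P'.PosSemidef) (hQ0 : Q.PosSemidef) :
    (Aᴴ * P * A * Q).trace.re ≤ (Aᴴ * P' * A * Q').trace.re := by
  have h1 : 0 ≤ (Aᴴ * (P' - P) * A * Q).trace.re :=
    trace_mul_re_nonneg ((Matrix.le_iff.1 hP).conjTranspose_mul_mul_same A) hQ0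
  have h2 : 0 ≤ (Aᴴ * P' * A * (Q' - Q)).trace.re :=
    trace_mul_re_nonneg (hP'.conjTranspose_mul_mul_same A) (Matrix.le_iff.1 hQ)
  simp only [mul_sub, sub_mul, Matrix.trace_sub, Complex.sub_re] at h1 h2
  linarith

/-- Löwner–Heinz for exponents in `[0, 1]`, combined with homogeneity of the power function. -/
lemma cfc_rpow_le {γ σ : Op n} (hγ : γ.PosDef) (hσ : σ.PosDef) {k : ℝ} (hk : 0 < k)
    (h : γ ≤ k • σ) {p : ℝ} (hp : p ∈ Set.Icc (0 : ℝ) 1) :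
    cfc (fun x : ℝ => x ^ p) γ ≤ (k ^ p) • cfc (fun x : ℝ => x ^ p) σ := by
  have hγ0 : 0 ≤ γ := Matrix.nonneg_iff_posSemidef.2 hγ.posSemidef
  have hσ0 : 0 ≤ σ := Matrix.nonneg_iff_posSemidef.2 hσ.posSemidef
  have hkσ : 0 ≤ k • σ := smul_nonneg hk.le hσ0
  have h1 := CFC.rpow_le_rpow hp h
  rw [CFC.rpow_eq_cfc_real hγ0, CFC.rpow_eq_cfc_real hkσ] at h1
  refine h1.trans_eq ?_
  rw [← cfc_comp_smul k (fun x : ℝ => x ^ p) σ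
    ((Matrix.finite_real_spectrum (A := σ)).image _ |>.continuousOn _) (show IsSelfAdjoint σ from hσ.1),
    ← cfc_const_mul _ _ _ (continuousOn_spectrum _ _)]
  refine cfc_congr fun x hx => ?_
  have hx0 := pos_of_mem_specFinset hσ (mem_specFinset.2 hx)
  simp only [smul_eq_mul]
  rw [Real.mul_rpow hk.le hx0.le]

lemma posSemidef_cfc_rpow {γ : Op n} (hγ : γ.PosDef) (p : ℝ) :
    (cfc (fun x : ℝ => x ^ p) γ).PosSemidef := by
  rw [← Matrix.nonneg_iff_posSemidef]
  exact cfc_nonneg fun x hx =>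
    (Real.rpow_pos_of_pos (pos_of_mem_specFinset hγ (mem_specFinset.2 hx)) p).le

/-- Under the integral, both powers of `γ` are dominated by powers of `k σ`; the exponents `1 - s`
and `s` sum to one, which leaves a single factor `k`. -/
lemma specForm_bracket_mono (w : ℝ) {γ σ : Op n} (hγ : γ.PosDef) (hσ : σ.PosDef) {k : ℝ}
    (hk : 0 < k) (h : γ ≤ k • σ) (A : Op n) :
    (specForm (fun x y => y * fFreq w (x / y)) γ A A).re
      ≤ k * (specForm (fun x y => y * fFreq w (x / y)) σ A A).re := by
  have hint : ∀ {ρ : Op n}, ρ.PosDef → Continuous fun s : ℝ => Real.exp (w * (1 / 2 - s)) *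
      (Aᴴ * cfc (fun x : ℝ => x ^ (1 - s)) ρ * A * cfc (fun x : ℝ => x ^ s) ρ).trace.re := by
    intro ρ hρ
    simp_rw [trace_cfc_rpow_eq_sum w hρ.1]
    exact continuous_finsetSum _ fun x hx => continuous_finsetSum _ fun y hy =>
      (continuous_weight w (pos_of_mem_specFinset hρ hx)
        (pos_of_mem_specFinset hρ hy)).mul continuous_const
  rw [specForm_bracket_eq_integral w hγ, specForm_bracket_eq_integral w hσ,
    ← intervalIntegral.integral_const_mul]
  refine intervalIntegral.integral_mono_on zero_le_one ((hint hγ).intervalIntegrable _ _)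
    ((continuous_const.mul (hint hσ)).intervalIntegrable _ _) fun s hs => ?_
  have hs' : 1 - s ∈ Set.Icc (0 : ℝ) 1 := ⟨by linarith [hs.2], by linarith [hs.1]⟩
  have h1 := trace_sandwich_mono A (cfc_rpow_le hγ hσ hk h hs') (cfc_rpow_le hγ hσ hk h hs)
    ((posSemidef_cfc_rpow hσ _).smul (Real.rpow_pos_of_pos hk _).le) (posSemidef_cfc_rpow hγ s)
  have h2 : (Aᴴ * (k ^ (1 - s) • cfc (fun x : ℝ => x ^ (1 - s)) σ) * A *
        (k ^ s • cfc (fun x : ℝ => x ^ s) σ)).trace.re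
      = k * (Aᴴ * cfc (fun x : ℝ => x ^ (1 - s)) σ * A * cfc (fun x : ℝ => x ^ s) σ).trace.re := by
    simp only [mul_smul_comm, smul_mul_assoc, smul_smul, Matrix.trace_smul]
    rw [← Real.rpow_add hk, show s + (1 - s) = 1 by ring, Real.rpow_one]
    simp
  rw [h2] at h1
  calc _ ≤ Real.exp (w * (1 / 2 - s)) * (k * _) :=
        mul_le_mul_of_nonneg_left h1 (Real.exp_pos _).le
    _ = _ := by ring

end Monotonicity

end QMS

namespace QMS

/-! ### Variation of a scalar along a curve of finite energy. -/

section LineIntegral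

/-- The energy may be a non-measurable function: only its lower integral enters. -/
lemma ofReal_abs_sub_le_energy {f f' b : ℝ → ℝ} {a : ℝ} (ha : 0 ≤ a)
    (hf : ∀ s ∈ Set.Icc (0 : ℝ) 1, HasDerivWithinAt f (f' s) (Set.Icc 0 1) s)
    (hcont : ContinuousOn f' (Set.Icc 0 1))
    (hb : ∀ s ∈ Set.Icc (0 : ℝ) 1, f' s ^ 2 ≤ a * b s) {s : ℝ} (hs : s ∈ Set.Icc (0 : ℝ) 1) :
    ENNReal.ofReal |f 1 - f s| ≤ ENNReal.ofReal (Real.sqrt a) *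
      (∫⁻ s in Set.Icc (0 : ℝ) 1, ENNReal.ofReal (b s)) ^ (1 / 2 : ℝ) := by
  have hsub : Set.Icc s 1 ⊆ Set.Icc 0 1 := Set.Icc_subset_Icc_left hs.1
  have hFTC : ∫ u in s..1, f' u = f 1 - f s := by
    refine intervalIntegral.integral_eq_sub_of_hasDerivAt_of_le hs.2
      (fun u hu => ((hf u (hsub hu)).continuousWithinAt).mono hsub) (fun u hu => ?_)
      ((hcont.mono (by rw [Set.uIcc_of_le hs.2]; exact hsub)).intervalIntegrable)
    exact (hf u (hsub (Set.Ioo_subset_Icc_self hu))).hasDerivAt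
      (Icc_mem_nhds (lt_of_le_of_lt hs.1 hu.1) hu.2)
  have h1 : ENNReal.ofReal |f 1 - f s| ≤ ∫⁻ u in Set.Icc (0 : ℝ) 1, ‖f' u‖ₑ := by
    rw [← hFTC, intervalIntegral.integral_of_le hs.2, ← Real.norm_eq_abs, ofReal_norm]
    refine (enorm_integral_le_lintegral_enorm _).trans ?_
    exact lintegral_mono_set (Set.Ioc_subset_Icc_self.trans hsub)
  have hmeas : AEMeasurable (fun u => ‖f' u‖ₑ) (volume.restrict (Set.Icc (0 : ℝ) 1)) :=
    (hcont.aestronglyMeasurable measurableSet_Icc).enorm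
  have h2 := ENNReal.lintegral_mul_le_Lp_mul_Lq (volume.restrict (Set.Icc (0 : ℝ) 1))
    Real.HolderConjugate.two_two hmeas (aemeasurable_const (b := (1 : ℝ≥0∞)))
  simp only [Pi.mul_apply, mul_one, ENNReal.one_rpow, lintegral_const,
    Measure.restrict_apply MeasurableSet.univ, Set.univ_inter, Real.volume_Icc, sub_zero,
    ENNReal.ofReal_one] at h2
  refine h1.trans (h2.trans ?_)
  have h3 : ∫⁻ u in Set.Icc (0 : ℝ) 1, ‖f' u‖ₑ ^ (2 : ℝ)
      ≤ ENNReal.ofReal a * ∫⁻ s in Set.Icc (0 : ℝ) 1, ENNReal.ofReal (b s) := by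
    -- Finiteness of the constant replaces measurability of `b` here.
    rw [← lintegral_const_mul' _ _ ENNReal.ofReal_ne_top]
    refine setLIntegral_mono' measurableSet_Icc fun u hu => ?_
    rw [← ENNReal.ofReal_mul ha, Real.enorm_eq_ofReal_abs,
      ENNReal.ofReal_rpow_of_nonneg (abs_nonneg _) zero_le_two]
    refine ENNReal.ofReal_le_ofReal ?_
    rw [Real.rpow_two, sq_abs]
    exact hb u hu
  calc _ ≤ (ENNReal.ofReal a * ∫⁻ s in Set.Icc (0 : ℝ) 1, ENNReal.ofReal (b s)) ^ (1 / 2 : ℝ) :=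
        ENNReal.rpow_le_rpow h3 (by norm_num)
    _ = _ := by
        rw [ENNReal.mul_rpow_of_nonneg _ _ (by norm_num),
          ENNReal.ofReal_rpow_of_nonneg ha (by norm_num), Real.sqrt_eq_rpow]

end LineIntegral

/-! ### Real trace functionals as test observables. -/

section RealTrace

variable {n : Type*} [Fintype n] [DecidableEq n]

/-- The real-linear functional `X ↦ Re Tr (g X)`. -/
noncomputable def reTrace (g : Op n) : Op n →L[ℝ] ℝ :=
  LinearMap.toContinuousLinearMap
    { toFun := fun X => (g * X).trace.re
      map_add' := fun X Y => by simp [mul_add]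
      map_smul' := fun c X => by simp }

lemma reTrace_apply (g X : Op n) : reTrace g X = (g * X).trace.re := rfl

/-- The real and imaginary parts of the entries are themselves values of `reTrace`. The test
operators are not Hermitian, which is why the gradient estimates below involve `gᴴ`. -/
lemma norm_le_sum_abs_reTrace (X : Op n) :
    ‖X‖ ≤ ∑ i, ∑ j, (|reTrace (Matrix.single j i 1) X|
      + |reTrace (Matrix.single j i (-Complex.I)) X|) * ‖(Matrix.single i j 1 : Op n)‖ := by
  nth_rewrite 1 [Matrix.matrix_eq_sum_single X]
  refine (norm_sum_le _ _).trans (Finset.sum_le_sum fun i _ => (norm_sum_le _ _).trans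
    (Finset.sum_le_sum fun j _ => ?_))
  have h1 : (Matrix.single i j (X i j) : Op n) = (X i j) • Matrix.single i j 1 := by
    rw [Matrix.smul_single, smul_eq_mul, mul_one]
  rw [h1, norm_smul]
  refine mul_le_mul_of_nonneg_right ?_ (norm_nonneg _)
  have h2 : ∀ c : ℂ, (Matrix.single j i c * X).trace = c * X i j := by
    intro c
    rw [Matrix.trace_single_mul]
    simp
  rw [reTrace_apply, reTrace_apply, h2, h2]
  simpa using Complex.norm_le_abs_re_add_abs_im (X i j)

end RealTrace

/-! ### Energy estimates along transport paths. -/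

namespace LindbladData

section

variable {n J : Type*} [Fintype n] [DecidableEq n]

lemma grad_apply (S : LindbladData n J) (U : Op n) (j : J) :
    S.grad U j = S.L j * U - U * S.L j := by
  simp [grad, comm]

end

variable {n J : Type*} [Fintype n] [DecidableEq n] [Fintype J]

/-- The real bilinear form of which `normSq` is the quadratic form. -/
noncomputable def energyForm (S : LindbladData n J) (ρ : Op n) (A B : J → Op n) : ℝ :=
  ∑ j, S.c j * (specForm (fun x y => y * fFreq (S.freq j) (x / y)) ρ (A j) (B j)).re

lemma normSq_eq_energyForm (S : LindbladData n J) {ρ : Op n} (hρ : ρ.IsHermitian)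
    (V : J → Op n) : S.normSq ρ V = S.energyForm ρ V V := by
  unfold normSq energyForm bracketVec bracketOp
  simp_rw [trace_weightedOp _ hρ, Complex.re_sum, Complex.re_ofReal_mul]

lemma energyForm_self_nonneg {S : LindbladData n J} (hc : ∀ j, 0 < S.c j) {ρ : Op n}
    (hρ : ρ.PosDef) (V : J → Op n) : 0 ≤ S.energyForm ρ V V :=
  Finset.sum_nonneg fun j _ => mul_nonneg (hc j).le <| specForm_self_nonneg _ fun _ hx _ hy =>
    (weight_pos _ (pos_of_mem_specFinset hρ hx) (pos_of_mem_specFinset hρ hy)).le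

/-- Cauchy–Schwarz, from the discriminant of the nonnegative quadratic `t ↦ ‖A + t B‖²`. -/
lemma energyForm_sq_le {S : LindbladData n J} (hc : ∀ j, 0 < S.c j) {ρ : Op n}
    (hρ : ρ.PosDef) (A B : J → Op n) :
    S.energyForm ρ A B ^ 2 ≤ S.energyForm ρ A A * S.energyForm ρ B B := by
  have key : ∀ t : ℝ, 0 ≤ S.energyForm ρ B B * (t * t) + (2 * S.energyForm ρ A B) * t
      + S.energyForm ρ A A := by
    intro t
    have h := energyForm_self_nonneg hc hρ (fun j => A j + (t : ℂ) • B j)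
    refine h.trans_eq ?_
    simp only [energyForm, Finset.sum_mul, Finset.mul_sum, ← Finset.sum_add_distrib]
    refine Finset.sum_congr rfl fun j _ => ?_
    rw [specForm_add_left, specForm_add_right, specForm_add_right, specForm_smul_left,
      specForm_smul_left, specForm_smul_right, specForm_smul_right]
    simp only [Complex.star_def, Complex.conj_ofReal, Complex.add_re, Complex.re_ofReal_mul]
    rw [specForm_conj_symm _ ρ (B j) (A j)]
    ring
  have := discrim_le_zero key
  unfold discrim at this
  nlinarith

lemma energyForm_self_le {S : LindbladData n J} (hc : ∀ j, 0 < S.c j) (V : J → Op n) :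
    ∃ C : ℝ, 0 ≤ C ∧ ∀ ρ : Op n, IsFullRankState ρ → S.energyForm ρ V V ≤ C := by
  have h0 : ∀ A : Op n, 0 ≤ (Aᴴ * A).trace.re := fun A =>
    (Complex.le_def.1 (Matrix.posSemidef_conjTranspose_mul_self A).trace_nonneg).1
  refine ⟨∑ j, S.c j * (Real.exp (|S.freq j| / 2) * ((V j)ᴴ * V j).trace.re),
    Finset.sum_nonneg fun j _ => mul_nonneg (hc j).le (mul_nonneg (Real.exp_pos _).le (h0 _)),
    fun ρ hρ => Finset.sum_le_sum fun j _ => mul_le_mul_of_nonneg_left ?_ (hc j).le⟩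
  have h1 := specForm_self_mono (V j) (w := fun x y => y * fFreq (S.freq j) (x / y))
    (w' := fun _ _ => Real.exp (|S.freq j| / 2) * 1) (ρ := ρ) fun x hx y hy => by
      rw [mul_one]
      exact weight_le _ (pos_of_mem_specFinset hρ.1 hx) (pos_of_mem_specFinset hρ.1 hy)
        (le_one_of_mem_specFinset hρ hx) (le_one_of_mem_specFinset hρ hy)
  refine h1.trans_eq ?_
  rw [specForm_mul (fun _ => Real.exp (|S.freq j| / 2)) (fun _ => 1) hρ.1.1,
    cfc_const _ _ (show IsSelfAdjoint ρ from hρ.1.1), cfc_const_one ℝ ρ (show IsSelfAdjoint ρ from hρ.1.1),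
    Algebra.algebraMap_eq_smul_one]
  simp [-Complex.ofReal_exp]

lemma energyForm_mono {S : LindbladData n J} (hc : ∀ j, 0 < S.c j) {γ σ : Op n}
    (hγ : γ.PosDef) (hσ : σ.PosDef) {k : ℝ} (hk : 0 < k) (h : γ ≤ k • σ) (V : J → Op n) :
    S.energyForm γ V V ≤ k * S.energyForm σ V V := by
  unfold energyForm
  rw [Finset.mul_sum]
  refine Finset.sum_le_sum fun j _ => ?_
  have := mul_le_mul_of_nonneg_left (specForm_bracket_mono (S.freq j) hγ hσ hk h (V j)) (hc j).le
  linarith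

/-- Integration by parts. -/
lemma reTrace_neg_div (S : LindbladData n J) {ρ : Op n} (hρ : ρ.IsHermitian) (g U : Op n) :
    reTrace g (-S.div (S.bracketVec ρ (S.grad U)))
      = S.energyForm ρ (S.grad gᴴ) (S.grad U) := by
  rw [reTrace_apply, div, energyForm, mul_neg, Matrix.trace_neg, Finset.mul_sum,
    Matrix.trace_sum, Complex.neg_re, Complex.re_sum, ← Finset.sum_neg_distrib]
  refine Finset.sum_congr rfl fun j _ => ?_
  rw [← trace_weightedOp _ hρ, mul_smul_comm, Matrix.trace_smul, smul_eq_mul,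
    Complex.re_ofReal_mul, ← mul_neg, ← Complex.neg_re]
  congr 2
  rw [grad_apply S gᴴ]
  have hb : S.bracketVec ρ (S.grad U) j = weightedOp (fFreq (S.freq j)) ρ (S.grad U j) := rfl
  rw [hb]
  set X := weightedOp (fFreq (S.freq j)) ρ (S.grad U j)
  have hcomm : comm X (S.L j)ᴴ = X * (S.L j)ᴴ - (S.L j)ᴴ * X := by simp [comm]
  rw [hcomm, Matrix.conjTranspose_sub, Matrix.conjTranspose_mul, Matrix.conjTranspose_mul,
    Matrix.conjTranspose_conjTranspose, mul_sub, sub_mul, Matrix.trace_sub, Matrix.trace_sub]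
  rw [← mul_assoc, ← mul_assoc, Matrix.trace_mul_comm (g * X), ← mul_assoc]
  ring

/-- A path moves an observable by at most its energy. -/
lemma IsTransportPath.ofReal_abs_reTrace_le {S : LindbladData n J} (hc : ∀ j, 0 < S.c j)
    {ρ σ : Op n} {γ U : ℝ → Op n} (h : S.IsTransportPath ρ σ γ U) (g : Op n) {a : ℝ} (ha : 0 ≤ a)
    (hga : ∀ s ∈ Set.Icc (0 : ℝ) 1, S.energyForm (γ s) (S.grad gᴴ) (S.grad gᴴ) ≤ a)
    {s : ℝ} (hs : s ∈ Set.Icc (0 : ℝ) 1) :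
    ENNReal.ofReal |reTrace g (σ - γ s)| ≤ ENNReal.ofReal (Real.sqrt a) *
      (∫⁻ s in Set.Icc (0 : ℝ) 1, ENNReal.ofReal (S.normSq (γ s) (S.grad (U s)))) ^ (1 / 2 : ℝ) := by
  rw [map_sub, ← h.target]
  -- The potential `U` carries no regularity in `s`. Continuity of the velocity comes from the
  -- smoothness of `γ`, so the velocity is written as `derivWithin`.
  have hd : ∀ s ∈ Set.Icc (0 : ℝ) 1, HasDerivWithinAt γ (derivWithin γ (Set.Icc 0 1) s)
      (Set.Icc 0 1) s := fun s hs => by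
    rw [(h.continuity s hs).derivWithin (uniqueDiffOn_Icc one_pos s hs)]
    exact h.continuity s hs
  refine ofReal_abs_sub_le_energy (f := fun s => reTrace g (γ s))
    (f' := fun s => reTrace g (derivWithin γ (Set.Icc 0 1) s)) ha
    (fun s hs => (reTrace g).hasFDerivAt.comp_hasDerivWithinAt s (hd s hs))
    ((reTrace g).continuous.comp_continuousOn
      (h.smooth.continuousOn_derivWithin (uniqueDiffOn_Icc one_pos) (by simp))) ?_ hs
  intro s hs
  have hst := (h.state s hs).1
  rw [(h.continuity s hs).derivWithin (uniqueDiffOn_Icc one_pos s hs),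
    reTrace_neg_div S hst.1, normSq_eq_energyForm S hst.1]
  exact (energyForm_sq_le hc hst _ _).trans
    (mul_le_mul_of_nonneg_right (hga s hs) (energyForm_self_nonneg hc hst _))

/-- The infimum need not be attained, hence the strict slack `w < w'`, removed later by a limit. -/
lemma exists_path_of_W₂_le {S : LindbladData n J} {ρ σ : Op n} {w w' : ℝ} (hw : 0 ≤ w)
    (h : S.W₂ ρ σ ≤ ENNReal.ofReal w) (hw' : w < w') :
    ∃ γ U : ℝ → Op n, S.IsTransportPath ρ σ γ U ∧
      (∫⁻ s in Set.Icc (0 : ℝ) 1, ENNReal.ofReal (S.normSq (γ s) (S.grad (U s)))) ^ (1 / 2 : ℝ)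
        ≤ ENNReal.ofReal w' := by
  have h1 : S.W₂ ρ σ < ENNReal.ofReal w' :=
    h.trans_lt ((ENNReal.ofReal_lt_ofReal_iff (hw.trans_lt hw')).2 hw')
  unfold W₂ at h1
  simp only [iInf_lt_iff] at h1
  obtain ⟨γ, U, hp, hlt⟩ := h1
  exact ⟨γ, U, hp, hlt.le⟩

/-- A priori confinement: the whole path, not only its endpoints, stays close to `σ`. The uniform
bound `energyForm_self_le` makes `K` independent of the path. -/
lemma exists_norm_sub_le {S : LindbladData n J} (hc : ∀ j, 0 < S.c j) :
    ∃ K : ℝ, 0 ≤ K ∧ ∀ (ρ σ : Op n) (γ U : ℝ → Op n) (w : ℝ), 0 ≤ w →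
      S.IsTransportPath ρ σ γ U →
      (∫⁻ s in Set.Icc (0 : ℝ) 1, ENNReal.ofReal (S.normSq (γ s) (S.grad (U s)))) ^ (1 / 2 : ℝ)
        ≤ ENNReal.ofReal w → ∀ s ∈ Set.Icc (0 : ℝ) 1, ‖σ - γ s‖ ≤ K * w := by
  choose C hC0 hC using fun g : Op n => energyForm_self_le hc (S.grad gᴴ)
  refine ⟨∑ i, ∑ j, (Real.sqrt (C (Matrix.single j i 1))
      + Real.sqrt (C (Matrix.single j i (-Complex.I)))) * ‖(Matrix.single i j 1 : Op n)‖,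
    Finset.sum_nonneg fun i _ => Finset.sum_nonneg fun j _ => by positivity, ?_⟩
  intro ρ σ γ U w hw hp hE s hs
  have key : ∀ g : Op n, |reTrace g (σ - γ s)| ≤ Real.sqrt (C g) * w := by
    intro g
    have h1 := hp.ofReal_abs_reTrace_le hc g (hC0 g) (fun s hs => hC g _ (hp.state s hs)) hs
    have h2 := h1.trans (mul_le_mul_right hE (ENNReal.ofReal (Real.sqrt (C g))))
    rw [← ENNReal.ofReal_mul (Real.sqrt_nonneg _)] at h2
    exact (ENNReal.ofReal_le_ofReal_iff (by positivity)).1 h2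
  refine (norm_le_sum_abs_reTrace _).trans ?_
  rw [Finset.sum_mul]
  refine Finset.sum_le_sum fun i _ => ?_
  rw [Finset.sum_mul]
  refine Finset.sum_le_sum fun j _ => ?_
  exact (mul_le_mul_of_nonneg_right (add_le_add (key _) (key _))
    (norm_nonneg (Matrix.single i j 1 : Op n))).trans_eq (by ring)

/-- Near `σ`, the distance to `σ` controls observables with the gradient norm at `σ`. -/
lemma exists_abs_reTrace_le [Nonempty n] {S : LindbladData n J} (hc : ∀ j, 0 < S.c j) {σ : Op n}
    (hσ : σ.PosDef) {δ : ℝ} (hδ : 0 < δ) :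
    ∃ r : ℝ, 0 < r ∧ ∀ (ρ g : Op n) (w : ℝ), g.IsHermitian → 0 ≤ w → w < r →
      S.W₂ ρ σ ≤ ENNReal.ofReal w →
      |reTrace g (σ - ρ)| ≤ Real.sqrt ((1 + δ) * S.normSq σ (S.grad g)) * w := by
  obtain ⟨K, hK0, hK⟩ := exists_norm_sub_le hc
  obtain ⟨l, hl, hlσ⟩ : ∃ l : ℝ, 0 < l ∧ l • (1 : Op n) ≤ σ := by
    obtain ⟨l, hl, h⟩ := (CFC.exists_pos_algebraMap_le_iff (show IsSelfAdjoint σ from hσ.1)).2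
      fun x hx => pos_of_mem_specFinset hσ (mem_specFinset.2 hx)
    exact ⟨l, hl, by rwa [Algebra.algebraMap_eq_smul_one] at h⟩
  -- With `σ ≥ l`, a deviation of at most `δ l` gives `γ s ≤ (1 + δ) σ`; the `+ 1` covers `K = 0`.
  refine ⟨δ * l / (K + 1), by positivity, ?_⟩
  intro ρ g w hg hw hwr hW
  have step : ∀ w', w < w' → w' < δ * l / (K + 1) →
      |reTrace g (σ - ρ)| ≤ Real.sqrt ((1 + δ) * S.normSq σ (S.grad g)) * w' := by
    intro w' hw' hw'r
    have hw'0 : 0 ≤ w' := hw.trans hw'.le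
    obtain ⟨γ, U, hp, hE⟩ := exists_path_of_W₂_le hw hW hw'
    have hle : ∀ s ∈ Set.Icc (0 : ℝ) 1, γ s ≤ (1 + δ) • σ := by
      intro s hs
      have h1 := hK ρ σ γ U w' hw'0 hp hE s hs
      have h2 : ‖γ s - σ‖ ≤ δ * l := by
        rw [norm_sub_rev]
        have h3 : (K + 1) * w' ≤ δ * l := by
          rw [lt_div_iff₀ (by positivity)] at hw'r
          linarith
        nlinarith
      have hsa : IsSelfAdjoint (γ s - σ) := (hp.state s hs).1.1.sub hσ.1
      have h4 := hsa.le_algebraMap_norm_self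
      rw [Algebra.algebraMap_eq_smul_one] at h4
      have h5 : ‖γ s - σ‖ • (1 : Op n) ≤ (δ * l) • 1 :=
        smul_le_smul_of_nonneg_right h2 zero_le_one
      have h6 : (δ * l) • (1 : Op n) ≤ δ • σ := by
        rw [mul_smul]
        exact smul_le_smul_of_nonneg_left hlσ hδ.le
      rw [add_smul, one_smul]
      have := h4.trans (h5.trans h6)
      rwa [sub_le_iff_le_add, add_comm] at this
    have hnn : 0 ≤ (1 + δ) * S.normSq σ (S.grad g) := by
      rw [normSq_eq_energyForm S hσ.1]
      exact mul_nonneg (by positivity) (energyForm_self_nonneg hc hσ _)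
    have h1 := hp.ofReal_abs_reTrace_le hc g hnn (fun s hs => by
      rw [hg.eq, normSq_eq_energyForm S hσ.1]
      exact energyForm_mono hc (hp.state s hs).1 hσ (by positivity) (hle s hs) _)
      (s := 0) (by simp)
    rw [hp.source] at h1
    have h2 := h1.trans (mul_le_mul_right hE (ENNReal.ofReal _))
    rw [← ENNReal.ofReal_mul (Real.sqrt_nonneg _)] at h2
    exact (ENNReal.ofReal_le_ofReal_iff (by positivity)).1 h2
  have hcl : Filter.Tendsto (fun w' => Real.sqrt ((1 + δ) * S.normSq σ (S.grad g)) * w')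
      (𝓝[>] w) (𝓝 (Real.sqrt ((1 + δ) * S.normSq σ (S.grad g)) * w)) :=
    ((continuous_const.mul continuous_id).tendsto w).mono_left nhdsWithin_le_nhds
  refine ge_of_tendsto hcl ?_
  filter_upwards [Ioo_mem_nhdsGT hwr] with w' hw'
  exact step w' hw'.1 hw'.2

end LindbladData

end QMS

namespace QMS

open Filter NormedSpace

/-! ### Differentiating the exponential. -/

section Duhamel

variable {𝔸 : Type*} [NormedRing 𝔸] [NormedAlgebra ℝ 𝔸] [CompleteSpace 𝔸]

lemma continuous_exp_of_real : Continuous (exp : 𝔸 → 𝔸) := by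
  let := NormedAlgebra.restrictScalars ℚ ℝ 𝔸
  exact exp_continuous

/-- Duhamel's formula. -/
lemma exp_sub_exp_eq_integral (X A : 𝔸) :
    exp X - exp A = ∫ s in (0 : ℝ)..1, exp (s • X) * (X - A) * exp ((1 - s) • A) := by
  have hexp := continuous_exp_of_real (𝔸 := 𝔸)
  have hd : ∀ s : ℝ, HasDerivAt (fun s : ℝ => exp (s • X) * exp ((1 - s) • A))
      (exp (s • X) * (X - A) * exp ((1 - s) • A)) s := by
    intro s
    have h1 := hasDerivAt_exp_smul_const X s
    have h2 := (hasDerivAt_exp_smul_const' A (1 - s)).scomp s ((hasDerivAt_id s).const_sub 1)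
    refine (h1.mul h2).congr_deriv ?_
    simp only [neg_smul, one_smul, Function.comp_apply]
    noncomm_ring
  rw [intervalIntegral.integral_eq_sub_of_hasDerivAt (fun s _ => hd s)]
  · simp [exp_zero]
  · exact Continuous.intervalIntegrable (by fun_prop) _ _

/-- By Duhamel, the difference quotient equals an integral that is continuous in `e`, including at
`e₀`. -/
lemma hasDerivAt_exp_add_smul (A B : 𝔸) (e₀ : ℝ) :
    HasDerivAt (fun e : ℝ => exp (A + e • B))
      (∫ s in (0 : ℝ)..1, exp (s • (A + e₀ • B)) * B * exp ((1 - s) • (A + e₀ • B))) e₀ := by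
  have hexp := continuous_exp_of_real (𝔸 := 𝔸)
  rw [hasDerivAt_iff_tendsto_slope]
  have hcont : Continuous fun e : ℝ =>
      ∫ s in (0 : ℝ)..1, exp (s • (A + e • B)) * B * exp ((1 - s) • (A + e₀ • B)) := by
    refine intervalIntegral.continuous_parametric_intervalIntegral_of_continuous' ?_ 0 1
    unfold Function.uncurry
    fun_prop
  refine (hcont.continuousAt.tendsto.mono_left nhdsWithin_le_nhds).congr' ?_
  filter_upwards [self_mem_nhdsWithin] with e he
  have he' : e - e₀ ≠ 0 := sub_ne_zero.2 he
  rw [slope_def_module, exp_sub_exp_eq_integral, ← intervalIntegral.integral_smul]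
  congr 1
  ext s
  rw [show A + e • B - (A + e₀ • B) = (e - e₀) • B by rw [sub_smul]; abel,
    mul_smul_comm, smul_mul_assoc, smul_smul, inv_mul_cancel₀ he', one_smul]

end Duhamel

/-! ### Gibbs perturbations of `σ`. -/

section GibbsFamily

variable {n : Type*} [Fintype n] [DecidableEq n]

lemma hasDerivAt_reTrace_exp (g A B : Op n) (e₀ : ℝ) :
    HasDerivAt (fun e : ℝ => reTrace g (exp (A + e • B)))
      (∫ s in (0 : ℝ)..1, reTrace g (exp (s • (A + e₀ • B)) * B * exp ((1 - s) • (A + e₀ • B))))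
      e₀ := by
  have hexp := continuous_exp_of_real (𝔸 := Op n)
  rw [ContinuousLinearMap.intervalIntegral_comp_comm]
  · exact (reTrace g).hasFDerivAt.comp_hasDerivAt e₀ (hasDerivAt_exp_add_smul A B e₀)
  · exact Continuous.intervalIntegrable (by fun_prop) _ _

/-- Cyclicity of the trace merges the two exponentials, so the Duhamel integrand is constant in `s`.
-/
lemma hasDerivAt_trace_exp (A B : Op n) (e₀ : ℝ) :
    HasDerivAt (fun e : ℝ => reTrace 1 (exp (A + e • B))) (reTrace B (exp (A + e₀ • B))) e₀ := by
  refine (hasDerivAt_reTrace_exp 1 A B e₀).congr_deriv ?_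
  have h : ∀ s : ℝ, reTrace 1 (exp (s • (A + e₀ • B)) * B * exp ((1 - s) • (A + e₀ • B)))
      = reTrace B (exp (A + e₀ • B)) := by
    intro s
    let := NormedAlgebra.restrictScalars ℚ ℝ (Op n)
    rw [reTrace_apply, reTrace_apply, one_mul, mul_assoc, Matrix.trace_mul_comm, mul_assoc,
      ← exp_add_of_commute, ← add_smul]
    · simp
    · exact ((Commute.refl (A + e₀ • B)).smul_left _).smul_right _
  simp_rw [h]
  simp

lemma exp_smul_log {σ : Op n} (hσ : σ.PosDef) (s : ℝ) :
    exp (s • CFC.log σ) = cfc (fun x : ℝ => x ^ s) σ := by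
  have h1 : s • CFC.log σ = cfc (fun x : ℝ => s * Real.log x) σ := by
    rw [CFC.log, cfc_const_mul _ _ _ (continuousOn_spectrum _ _)]
  have h2 : IsSelfAdjoint (s • CFC.log σ) := by rw [h1]; exact cfc_predicate _ σ
  rw [← CFC.real_exp_eq_normedSpace_exp h2, h1,
    ← cfc_comp' Real.exp (fun x : ℝ => s * Real.log x) σ Real.continuous_exp.continuousOn
      (continuousOn_spectrum _ _) (show IsSelfAdjoint σ from hσ.1)]
  refine cfc_congr fun x hx => ?_
  have hx0 := pos_of_mem_specFinset hσ (mem_specFinset.2 hx)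
  rw [Real.rpow_def_of_pos hx0, mul_comm]

/-- The Kubo–Mori variance is the linear response of a Gibbs state. -/
lemma hasDerivAt_reTrace_exp_log {σ : Op n} (hσ : σ.PosDef) {g : Op n} (hg : g.IsHermitian) :
    HasDerivAt (fun e : ℝ => reTrace g (exp (CFC.log σ + e • g)))
      (specForm (fun x y => y * fFreq 0 (x / y)) σ g g).re 0 := by
  refine (hasDerivAt_reTrace_exp g (CFC.log σ) g 0).congr_deriv ?_
  rw [specForm_bracket_eq_integral 0 hσ]
  congr 1
  ext s
  rw [zero_smul, add_zero, exp_smul_log hσ, exp_smul_log hσ, reTrace_apply, hg.eq, zero_mul,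
    Real.exp_zero, one_mul, mul_assoc (cfc _ σ), ← mul_assoc, Matrix.trace_mul_comm,
    mul_assoc (g * _)]

lemma posDef_exp {A : Op n} (hA : IsSelfAdjoint A) : (exp A).PosDef := by
  let := NormedAlgebra.restrictScalars ℚ ℝ (Op n)
  exact (Matrix.nonneg_iff_posSemidef.1 hA.exp_nonneg).posDef_iff_isUnit.2 (isUnit_exp A)

lemma trace_eq_reTrace {A : Op n} (hA : A.IsHermitian) : A.trace = (reTrace 1 A : ℂ) := by
  rw [reTrace_apply, one_mul]
  refine (Complex.conj_eq_iff_re.1 ?_).symm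
  rw [← Complex.star_def, ← Matrix.trace_conjTranspose, hA.eq]

lemma reTrace_one_pos [Nonempty n] {A : Op n} (hA : A.PosDef) : 0 < reTrace 1 A := by
  rw [reTrace_apply, one_mul]
  exact (Complex.lt_def.1 hA.trace_pos).1

/-- The Gibbs state with Hamiltonian `-A`. -/
noncomputable def gibbs (A : Op n) : Op n := (reTrace 1 (exp A))⁻¹ • exp A

lemma isFullRankState_gibbs [Nonempty n] {A : Op n} (hA : IsSelfAdjoint A) :
    IsFullRankState (gibbs A) := by
  have hp := posDef_exp hA
  have ht := reTrace_one_pos hp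
  refine ⟨hp.smul (inv_pos.2 ht), ?_⟩
  rw [gibbs, Matrix.trace_smul, trace_eq_reTrace hp.1, Complex.real_smul, Complex.ofReal_inv]
  exact inv_mul_cancel₀ (by exact_mod_cast ht.ne')

/-- The logarithm of the Gibbs state is `log σ + e g - log Z`, so `log σ` cancels. -/
lemma relEntropy_gibbs [Nonempty n] {σ g : Op n} (hg : g.IsHermitian) (e : ℝ) :
    relEntropy (gibbs (CFC.log σ + e • g)) σ
      = e * reTrace g (gibbs (CFC.log σ + e • g))
        - Real.log (reTrace 1 (exp (CFC.log σ + e • g))) := by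
  set A := CFC.log σ + e • g with hAdef
  have hA : IsSelfAdjoint A := IsSelfAdjoint.log.add ((IsSelfAdjoint.all e).smul (show IsSelfAdjoint g from hg))
  have hp := posDef_exp hA
  have ht := reTrace_one_pos hp
  have hs := isFullRankState_gibbs hA
  have hlog : CFC.log (gibbs A) = algebraMap ℝ (Op n) (-Real.log (reTrace 1 (exp A))) + A := by
    rw [gibbs, CFC.log_smul' _ (inv_pos.2 ht) (Matrix.isStrictlyPositive_iff_posDef.2 hp),
      CFC.log_exp A hA, Real.log_inv]
  rw [relEntropy, hlog]
  have h1 : algebraMap ℝ (Op n) (-Real.log (reTrace 1 (exp A))) + A - CFC.log σ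
      = (-Real.log (reTrace 1 (exp A))) • (1 : Op n) + e • g := by
    rw [Algebra.algebraMap_eq_smul_one, hAdef]
    abel
  rw [h1, mul_add, Matrix.trace_add, mul_smul_comm, mul_smul_comm, Matrix.trace_smul,
    Matrix.trace_smul, mul_one, hs.2, Matrix.trace_mul_comm (gibbs A), reTrace_apply g]
  simp
  ring

/-- One application of l'Hôpital; the second derivative is needed at `0` only. -/
lemma tendsto_div_sq_of_hasDerivAt {F m : ℝ → ℝ} {v : ℝ} (hF : ∀ e, HasDerivAt F (m e) e)
    (hF0 : F 0 = 0) (hm0 : m 0 = 0) (hm : HasDerivAt m v 0) :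
    Tendsto (fun e => F e / e ^ 2) (𝓝[≠] 0) (𝓝 (v / 2)) := by
  have hme : Tendsto (fun e => m e / e) (𝓝[≠] 0) (𝓝 v) := by
    have h := hasDerivAt_iff_tendsto_slope.1 hm
    refine h.congr fun e => ?_
    rw [slope_def_field, hm0, sub_zero, sub_zero]
  refine HasDerivAt.lhopital_zero_nhdsNE (f' := m) (g' := fun e => 2 * e)
    (Eventually.of_forall hF) (Eventually.of_forall fun e => ?_) ?_ ?_ ?_ ?_
  · simpa using hasDerivAt_pow 2 e
  · filter_upwards [self_mem_nhdsWithin] with e he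
    exact mul_ne_zero two_ne_zero he
  · have := (hF 0).continuousAt.tendsto.mono_left (nhdsWithin_le_nhds (s := {0}ᶜ))
    rwa [hF0] at this
  · have : Tendsto (fun e : ℝ => e ^ 2) (𝓝 0) (𝓝 (0 ^ 2)) := (continuous_pow 2).tendsto 0
    rw [zero_pow two_ne_zero] at this
    exact this.mono_left nhdsWithin_le_nhds
  · refine (hme.div_const 2).congr fun e => ?_
    rw [div_div, mul_comm]

end GibbsFamily

/-! ### Linearisation of the transport inequality. -/

namespace LindbladData

variable {n J : Type*} [Fintype n] [DecidableEq n] [Fintype J]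

/-- The Poincaré inequality for the Kubo–Mori inner product and self-adjoint observables. -/
lemma kuboMori_le_of_transportCost [Nonempty n] {S : LindbladData n J} (hc : ∀ j, 0 < S.c j)
    {σ : Op n} (hσ : IsFullRankState σ) {c₂ : ℝ} (hc₂ : 0 < c₂) (hTC : S.TransportCost₂ σ c₂)
    {g : Op n} (hg : g.IsHermitian) (hσg : reTrace g σ = 0) :
    (specForm (fun x y => y * fFreq 0 (x / y)) σ g g).re
      ≤ c₂ * S.energyForm σ (S.grad g) (S.grad g) := by
  set v := (specForm (fun x y => y * fFreq 0 (x / y)) σ g g).re with hv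
  set N := S.energyForm σ (S.grad g) (S.grad g) with hN
  have hv0 : 0 ≤ v := specForm_self_nonneg g fun x hx y hy =>
    (weight_pos 0 (pos_of_mem_specFinset hσ.1 hx) (pos_of_mem_specFinset hσ.1 hy)).le
  have hN0 : 0 ≤ N := energyForm_self_nonneg hc hσ.1 _
  set A : ℝ → Op n := fun e => CFC.log σ + e • g with hA
  have hsa : ∀ e, IsSelfAdjoint (A e) := fun e =>
    IsSelfAdjoint.log.add ((IsSelfAdjoint.all e).smul (show IsSelfAdjoint g from hg))
  set Z : ℝ → ℝ := fun e => reTrace 1 (exp (A e)) with hZ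
  have hZpos : ∀ e, 0 < Z e := fun e => reTrace_one_pos (posDef_exp (hsa e))
  have hA0 : exp (A 0) = σ := by
    simp only [hA, zero_smul, add_zero]
    exact CFC.exp_log σ (Matrix.isStrictlyPositive_iff_posDef.2 hσ.1)
  have hZ0 : Z 0 = 1 := by
    simp only [hZ]
    rw [hA0, reTrace_apply, one_mul, hσ.2, Complex.one_re]
  set m : ℝ → ℝ := fun e => reTrace g (gibbs (A e)) with hm
  have hmdiv : ∀ e, m e = reTrace g (exp (A e)) / Z e := by
    intro e
    simp only [hm, gibbs, map_smul, smul_eq_mul]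
    rw [div_eq_inv_mul]
  have hm0 : m 0 = 0 := by rw [hmdiv, hA0, hσg, zero_div]
  have hZd : ∀ e, HasDerivAt Z (reTrace g (exp (A e))) e := fun e =>
    hasDerivAt_trace_exp (CFC.log σ) g e
  have hlogd : ∀ e, HasDerivAt (fun e => Real.log (Z e)) (m e) e := fun e => by
    rw [hmdiv]
    exact (hZd e).log (hZpos e).ne'
  have hmd : HasDerivAt m v 0 := by
    have h := (hasDerivAt_reTrace_exp_log hσ.1 hg).div (hZd 0) (hZpos 0).ne'
    have h2 : m = (fun e => reTrace g (exp (CFC.log σ + e • g))) / Z := by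
      ext e; rw [hmdiv]; rfl
    rw [h2]
    refine h.congr_deriv ?_
    rw [hZ0, hA0, hσg]
    simp [hv]
  set D : ℝ → ℝ := fun e => relEntropy (gibbs (A e)) σ with hD
  have hDeq : ∀ e, D e = e * m e - Real.log (Z e) := fun e => relEntropy_gibbs hg e
  have hm1 : Tendsto (fun e => m e / e) (𝓝[≠] 0) (𝓝 v) := by
    refine (hasDerivAt_iff_tendsto_slope.1 hmd).congr fun e => ?_
    rw [slope_def_field, hm0, sub_zero, sub_zero]
  -- `e m` contributes `v` and `log Z` contributes `v / 2`, since `(log Z)' = m`.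
  have hD1 : Tendsto (fun e => D e / e ^ 2) (𝓝[≠] 0) (𝓝 (v / 2)) := by
    have h := hm1.sub (tendsto_div_sq_of_hasDerivAt hlogd (by rw [hZ0, Real.log_one]) hm0 hmd)
    rw [show v - v / 2 = v / 2 by ring] at h
    refine h.congr' ?_
    filter_upwards [self_mem_nhdsWithin] with e he
    have he' : e ≠ 0 := he
    rw [hDeq]
    field_simp
  have hD0 : Tendsto D (𝓝[≠] 0) (𝓝 0) := by
    have h : ContinuousAt (fun e => e * m e - Real.log (Z e)) 0 :=
      (continuousAt_id.mul hmd.continuousAt).sub (hlogd 0).continuousAt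
    have h' := h.tendsto.mono_left (nhdsWithin_le_nhds (s := {0}ᶜ))
    rw [hZ0, Real.log_one, zero_mul, sub_zero] at h'
    exact h'.congr fun e => (hDeq e).symm
  have hw0 : Tendsto (fun e => Real.sqrt (2 * c₂ * D e)) (𝓝[≠] 0) (𝓝 0) := by
    have h := (hD0.const_mul (2 * c₂)).sqrt
    rwa [mul_zero, Real.sqrt_zero] at h
  -- The squared root is kept unsimplified: only the limit `v / 2`, not each `D e`, has to be
  -- nonnegative.
  have hw1 : Tendsto (fun e => Real.sqrt (2 * c₂ * (D e / e ^ 2)) ^ 2) (𝓝[≠] 0) (𝓝 (c₂ * v)) := by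
    have h := ((hD1.const_mul (2 * c₂)).sqrt).pow 2
    rwa [Real.sq_sqrt (by positivity), show 2 * c₂ * (v / 2) = c₂ * v by ring] at h
  have main : ∀ δ : ℝ, 0 < δ → v ^ 2 ≤ (1 + δ) * N * (c₂ * v) := by
    intro δ hδ
    obtain ⟨r, hr, hloc⟩ := exists_abs_reTrace_le hc hσ.1 hδ
    refine le_of_tendsto_of_tendsto (hm1.pow 2) (hw1.const_mul ((1 + δ) * N)) ?_
    filter_upwards [self_mem_nhdsWithin, hw0.eventually_lt_const hr] with e he her
    have he' : e ≠ 0 := he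
    have h1 := hloc (gibbs (A e)) g _ hg (Real.sqrt_nonneg _) her
      (hTC _ (isFullRankState_gibbs (hsa e)))
    rw [map_sub, hσg, zero_sub, abs_neg, normSq_eq_energyForm S hσ.1.1] at h1
    have h2 : m e ^ 2 ≤ (1 + δ) * N * Real.sqrt (2 * c₂ * D e) ^ 2 := by
      have h3 := pow_le_pow_left₀ (abs_nonneg _) h1 2
      rwa [sq_abs, mul_pow, Real.sq_sqrt (by positivity)] at h3
    have h4 : Real.sqrt (2 * c₂ * (D e / e ^ 2)) ^ 2 = Real.sqrt (2 * c₂ * D e) ^ 2 / e ^ 2 := by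
      rw [← mul_div_assoc, Real.sqrt_div' _ (sq_nonneg e), div_pow, Real.sq_sqrt (sq_nonneg e)]
    rw [h4, div_pow, ← mul_div_assoc]
    exact div_le_div_of_nonneg_right h2 (sq_nonneg e)
  have hlim : v ^ 2 ≤ N * (c₂ * v) := by
    have h : Tendsto (fun δ : ℝ => (1 + δ) * N * (c₂ * v)) (𝓝[>] 0) (𝓝 ((1 + 0) * N * (c₂ * v))) :=
      ((by fun_prop : Continuous fun δ : ℝ => (1 + δ) * N * (c₂ * v)).tendsto 0).mono_left
        nhdsWithin_le_nhds
    rw [add_zero, one_mul] at h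
    exact ge_of_tendsto h (by filter_upwards [self_mem_nhdsWithin] with δ hδ using main δ hδ)
  -- One factor `v` is cancelled when positive; for `v = 0` the claim is nonnegativity of `N`.
  rcases hv0.eq_or_lt with h | h
  · rw [← h]; positivity
  · nlinarith

end LindbladData

end QMS

namespace QMS

open Filter

/-! ### Eigenvectors of the modular operator and its functional calculus. -/

section Intertwining

lemma mul_conjTranspose_eigenvector {n : Type*} [Fintype n] {σ L : Op n} (hσ : σ.IsHermitian) {c : ℝ}
    (h : σ * L = (c : ℂ) • (L * σ)) : Lᴴ * σ = (c : ℂ) • (σ * Lᴴ) := by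
  have := congrArg Matrix.conjTranspose h
  simpa [Matrix.conjTranspose_mul, Matrix.conjTranspose_smul, hσ.eq] using this

variable {n : Type*} [Fintype n] [DecidableEq n]

lemma sum_mul_specProj_mul {σ : Op n} (hσ : σ.IsHermitian) (A B : Op n) :
    ∑ z ∈ specFinset σ, A * specProj σ z * B = A * B := by
  rw [← Finset.sum_mul, ← Finset.mul_sum, sum_specProj hσ, mul_one]

/-- `L` sends the `z`-eigenspace of `σ` into the `c z`-eigenspace, so all other blocks vanish. -/
lemma specProj_mul_eigenvector_mul_specProj {σ L : Op n} (hσ : σ.IsHermitian) {c : ℝ}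
    (hL : σ * L = (c : ℂ) • (L * σ)) {x z : ℝ} (hx : x ∈ specFinset σ) (hz : z ∈ specFinset σ) :
    specProj σ x * L * specProj σ z = 0 ∨ x = c * z := by
  have h1 : (x : ℂ) • (specProj σ x * L * specProj σ z)
      = ((c * z : ℝ) : ℂ) • (specProj σ x * L * specProj σ z) := by
    calc (x : ℂ) • (specProj σ x * L * specProj σ z)
        = specProj σ x * (σ * L) * specProj σ z := by
          rw [← mul_assoc, specProj_mul_self hσ hx, smul_mul_assoc, smul_mul_assoc]
      _ = (c : ℂ) • (specProj σ x * L * (σ * specProj σ z)) := by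
          rw [hL, mul_smul_comm, smul_mul_assoc]
          simp only [mul_assoc]
      _ = _ := by
          rw [self_mul_specProj hσ hz, mul_smul_comm, smul_smul]
          push_cast
          rfl
  rw [← sub_eq_zero, ← sub_smul, smul_eq_zero, sub_eq_zero] at h1
  exact h1.symm.imp id fun h => by exact_mod_cast h

/-- On a nonzero block `x = c z`, hence `c⁻¹ (x / y) = z / y`: multiplication by `L` rescales the
argument of `φ`. -/
lemma modularFun_mul_left_eigenvector (φ : ℝ → ℝ) {σ L : Op n} (hσ : σ.IsHermitian) {c : ℝ}
    (hc : c ≠ 0) (hL : σ * L = (c : ℂ) • (L * σ)) (f : Op n) :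
    modularFun (fun t => φ (c⁻¹ * t)) σ (L * f) = L * modularFun φ σ f := by
  refine ext_specProj hσ fun x hx y hy => ?_
  rw [specProj_modularFun _ _ _ hx hy, ← mul_assoc, ← mul_assoc,
    ← sum_mul_specProj_mul hσ (specProj σ x * L) f,
    ← sum_mul_specProj_mul hσ (specProj σ x * L) (modularFun φ σ f),
    Finset.sum_mul, Finset.sum_mul, Finset.smul_sum]
  refine Finset.sum_congr rfl fun z hz => ?_
  rcases specProj_mul_eigenvector_mul_specProj hσ hL hx hz with h | h
  · rw [h]; simp
  · have h2 : specProj σ x * L * specProj σ z * modularFun φ σ f * specProj σ y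
        = specProj σ x * L * (specProj σ z * (specProj σ z * modularFun φ σ f * specProj σ y)) := by
      have hzz := specProj_mul_specProj σ z z
      rw [if_pos rfl] at hzz
      rw [← mul_assoc (specProj σ z), ← mul_assoc (specProj σ z), hzz]
      simp only [mul_assoc]
    have hzz := specProj_mul_specProj σ z z
    rw [if_pos rfl] at hzz
    rw [h2, specProj_modularFun _ _ _ hz hy, mul_smul_comm, mul_smul_comm,
      ← mul_assoc (specProj σ z), ← mul_assoc (specProj σ z), hzz]
    rw [show c⁻¹ * (x / y) = z / y by rw [h]; field_simp]
    simp only [mul_assoc]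

lemma modularFun_mul_right_eigenvector (φ : ℝ → ℝ) {σ L : Op n} (hσ : σ.PosDef) {c : ℝ}
    (hc : c ≠ 0) (hL : σ * L = (c : ℂ) • (L * σ)) (f : Op n) :
    modularFun (fun t => φ (c⁻¹ * t)) σ (f * L) = modularFun φ σ f * L := by
  refine ext_specProj hσ.1 fun x hx y hy => ?_
  have hsplit : ∀ A : Op n, specProj σ x * (A * L) * specProj σ y
      = ∑ z ∈ specFinset σ, (specProj σ x * A * specProj σ z) *
          (specProj σ z * L * specProj σ y) := by
    intro A
    rw [show specProj σ x * (A * L) * specProj σ y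
      = (specProj σ x * A) * (L * specProj σ y) by simp only [mul_assoc],
      ← sum_mul_specProj_mul hσ.1]
    refine Finset.sum_congr rfl fun z _ => ?_
    have hzz := specProj_mul_specProj σ z z
    rw [if_pos rfl] at hzz
    nth_rewrite 1 [← hzz]
    simp only [mul_assoc]
  rw [specProj_modularFun _ _ _ hx hy, hsplit, hsplit, Finset.smul_sum]
  refine Finset.sum_congr rfl fun z hz => ?_
  rcases specProj_mul_eigenvector_mul_specProj hσ.1 hL hz hy with h | h
  · rw [h]; simp
  · rw [specProj_modularFun _ _ _ hx hz, smul_mul_assoc]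
    rw [show c⁻¹ * (x / y) = x / z by
      have := (pos_of_mem_specFinset hσ hy).ne'
      rw [h]; field_simp]

lemma mul_eigenvector_of_modularOp {σ L : Op n} (hσ : σ.PosDef) {c : ℝ}
    (h : modularOp σ L = (c : ℂ) • L) : σ * L = (c : ℂ) • (L * σ) := by
  have hdet : IsUnit σ.det := (Matrix.isUnit_iff_isUnit_det σ).1 hσ.isUnit
  rw [← smul_mul_assoc, ← h, modularOp, Matrix.nonsing_inv_mul_cancel_right _ _ hdet]

lemma specForm_modularFun (w : ℝ → ℝ → ℝ) (a b : ℝ → ℝ) (ρ A B : Op n) :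
    specForm w ρ (modularFun a ρ A) (modularFun b ρ B)
      = specForm (fun x y => w x y * (a (x / y) * b (x / y))) ρ A B := by
  unfold specForm
  refine Finset.sum_congr rfl fun x hx => Finset.sum_congr rfl fun y hy => ?_
  rw [trace_conjTranspose_specProj, specProj_modularFun _ _ _ hx hy,
    specProj_modularFun _ _ _ hx hy, trace_conjTranspose_specProj ρ A B, Matrix.conjTranspose_smul,
    smul_mul_assoc, mul_smul_comm, Matrix.trace_smul, Matrix.trace_smul]
  simp only [Complex.star_def, Complex.conj_ofReal, smul_eq_mul]
  push_cast
  ring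

lemma modularFun_conjTranspose {φ : ℝ → ℝ} {ρ : Op n}
    (h : ∀ x ∈ specFinset ρ, ∀ y ∈ specFinset ρ, φ (x / y) = φ (y / x)) (A : Op n) :
    (modularFun φ ρ A)ᴴ = modularFun φ ρ Aᴴ := by
  rw [modularFun_apply, modularFun_apply, Matrix.conjTranspose_sum, Finset.sum_comm]
  simp_rw [Matrix.conjTranspose_sum]
  rw [Finset.sum_comm]
  refine Finset.sum_comm.trans (Finset.sum_congr rfl fun x hx => Finset.sum_congr rfl fun y hy => ?_)
  rw [Matrix.conjTranspose_smul, Matrix.conjTranspose_mul, Matrix.conjTranspose_mul,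
    conjTranspose_specProj, conjTranspose_specProj, h x hx y hy, ← mul_assoc]
  simp

lemma specForm_one {w w' : ℝ → ℝ → ℝ} {ρ : Op n} (B : Op n)
    (h : ∀ x ∈ specFinset ρ, w x x = w' x x) : specForm w ρ 1 B = specForm w' ρ 1 B := by
  unfold specForm
  refine Finset.sum_congr rfl fun x hx => Finset.sum_congr rfl fun y hy => ?_
  by_cases hxy : x = y
  · rw [← hxy, h x hx]
  · rw [Matrix.trace_mul_comm, Matrix.conjTranspose_one, one_mul, ← mul_assoc,
      specProj_mul_specProj, if_neg (Ne.symm hxy)]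
    simp

/-- Only diagonal blocks survive the trace, and there the modular ratio is `1`. Consequently
`φ(Δ_σ)` preserves centredness. -/
lemma trace_modularFun_mul (φ : ℝ → ℝ) {σ : Op n} (hσ : σ.PosDef) (A : Op n) :
    (modularFun φ σ A * σ).trace = φ 1 * (A * σ).trace := by
  have h1 := trace_weightedOp φ hσ.1 1 A
  rw [Matrix.conjTranspose_one, one_mul] at h1
  have h2 : weightedOp φ σ A = modularFun φ σ A * σ := rfl
  rw [← h2, h1, specForm_one A (w' := fun _ y => φ 1 * y) fun x hx => by
    rw [div_self (pos_of_mem_specFinset hσ hx).ne', mul_comm],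
    specForm_mul (fun _ => φ 1) (fun y => y) hσ.1, cfc_const _ _ (show IsSelfAdjoint σ from hσ.1),
    cfc_id' ℝ σ (show IsSelfAdjoint σ from hσ.1), Algebra.algebraMap_eq_smul_one]
  simp

lemma modularFun_one (φ : ℝ → ℝ) {σ : Op n} (hσ : σ.PosDef) :
    modularFun φ σ 1 = (φ 1 : ℂ) • 1 := by
  refine ext_specProj hσ.1 fun x hx y hy => ?_
  rw [specProj_modularFun _ _ _ hx hy, mul_smul_comm, smul_mul_assoc, mul_one,
    specProj_mul_specProj]
  split_ifs with h
  · rw [← h, div_self (pos_of_mem_specFinset hσ hx).ne']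
  · simp

lemma modularFun_of_eq_one {φ : ℝ → ℝ} {σ : Op n} (hσ : σ.IsHermitian)
    (h : ∀ x ∈ specFinset σ, ∀ y ∈ specFinset σ, φ (x / y) = 1) (A : Op n) :
    modularFun φ σ A = A := by
  refine ext_specProj hσ fun x hx y hy => ?_
  rw [specProj_modularFun _ _ _ hx hy, h x hx y hy]
  simp

end Intertwining

/-! ### The lower bound `κ ≥ 1`. -/

section OperatorNorm

variable {n : Type*} [Fintype n] [DecidableEq n]

/-- Invertibility ensures that `Ring.inverse` in `κ` is the true inverse rather than its default
value `0`. -/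
lemma isUnit_weightedOp {φ : ℝ → ℝ} {σ : Op n} (hσ : σ.PosDef) (hφ : ∀ t, 0 < t → 0 < φ t) :
    IsUnit (weightedOp φ σ) := by
  have hdet : IsUnit σ.det := (Matrix.isUnit_iff_isUnit_det σ).1 hσ.isUnit
  have hpos : ∀ x ∈ specFinset σ, ∀ y ∈ specFinset σ, φ (x / y) ≠ 0 := fun x hx y hy =>
    (hφ _ (div_pos (pos_of_mem_specFinset hσ hx) (pos_of_mem_specFinset hσ hy))).ne'
  refine ⟨⟨weightedOp φ σ, modularFun (fun t => (φ t)⁻¹) σ ∘ₗ LinearMap.mulRight ℂ σ⁻¹, ?_, ?_⟩,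
    rfl⟩
  · ext1 A
    change modularFun φ σ (modularFun (fun t => (φ t)⁻¹) σ (A * σ⁻¹)) * σ = A
    rw [modularFun_modularFun _ _ hσ.1, modularFun_of_eq_one hσ.1
      fun x hx y hy => mul_inv_cancel₀ (hpos x hx y hy)]
    exact Matrix.nonsing_inv_mul_cancel_right _ _ hdet
  · ext1 A
    change modularFun (fun t => (φ t)⁻¹) σ (modularFun φ σ A * σ * σ⁻¹) = A
    rw [Matrix.mul_nonsing_inv_cancel_right _ _ hdet, modularFun_modularFun _ _ hσ.1,
      modularFun_of_eq_one hσ.1 fun x hx y hy => inv_mul_cancel₀ (hpos x hx y hy)]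

lemma bracketOp_one (w : ℝ) {σ : Op n} (hσ : σ.PosDef) :
    bracketOp σ w 1 = (fFreq w 1 : ℂ) • σ := by
  change modularFun (fFreq w) σ 1 * σ = _
  rw [modularFun_one _ hσ, smul_mul_assoc, one_mul]

lemma one_le_superNorm_of_fixed {Φ : SuperOp n} {A : Op n} (hA : A ≠ 0) (h : Φ A = A) :
    1 ≤ superNorm Φ := by
  have h1 := (LinearMap.toContinuousLinearMap Φ).le_opNorm A
  rw [LinearMap.coe_toContinuousLinearMap', h] at h1
  exact le_of_mul_le_mul_right (by rwa [one_mul]) (norm_pos_iff.2 hA)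

/-- Both `[σ]_w` and `[σ]_{-w}` send `1` to the same multiple of `σ`, so the composite fixes `σ`. -/
lemma one_le_superNorm_bracketOp [Nonempty n] (w : ℝ) {σ : Op n} (hσ : σ.PosDef) :
    1 ≤ superNorm (bracketOp σ w ∘ₗ Ring.inverse (bracketOp σ (-w))) := by
  have hunit : IsUnit (bracketOp σ (-w)) := isUnit_weightedOp hσ fun t ht => fFreq_pos _ ht
  have h1 : Ring.inverse (bracketOp σ (-w)) (bracketOp σ (-w) 1) = 1 := by
    rw [← Module.End.mul_apply, Ring.inverse_mul_cancel _ hunit, Module.End.one_apply]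
  have hf : (fFreq w 1 : ℂ) ≠ 0 := by exact_mod_cast (fFreq_pos w one_pos).ne'
  rw [bracketOp_one _ hσ, fFreq_one_neg, map_smul] at h1
  refine one_le_superNorm_of_fixed (A := σ) ?_ ?_
  · rintro rfl
    exact absurd hσ.trace_pos (by simp)
  · rw [LinearMap.comp_apply]
    have h2 : Ring.inverse (bracketOp σ (-w)) σ = (fFreq w 1 : ℂ)⁻¹ • 1 := by
      rw [← h1, smul_smul, inv_mul_cancel₀ hf, one_smul]
    rw [h2, map_smul, bracketOp_one _ hσ, smul_smul, inv_mul_cancel₀ hf, one_smul]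

lemma LindbladData.one_le_κ [Nonempty n] {J : Type*} [Finite J] [Nonempty J]
    (S : LindbladData n J) {σ : Op n} (hσ : σ.PosDef) : 1 ≤ S.κ σ := by
  obtain ⟨j⟩ := ‹Nonempty J›
  exact (one_le_superNorm_bracketOp (S.freq j) hσ).trans
    (le_ciSup (f := fun j => superNorm
      (bracketOp σ (S.freq j) ∘ₗ Ring.inverse (bracketOp σ (-S.freq j))))
      (Set.finite_range _).bddAbove j)

end OperatorNorm

/-! ### Dirichlet form and gradient. -/

section Generator

variable {n J : Type*} [Fintype n] [DecidableEq n]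

lemma LindbladData.modularFun_grad {S : LindbladData n J} {σ : Op n} (hσ : σ.PosDef) {j : J}
    (hL : modularOp σ (S.L j) = (Real.exp (-S.freq j) : ℂ) • S.L j) (φ : ℝ → ℝ) (f : Op n) :
    S.grad (modularFun φ σ f) j
      = modularFun (fun t => φ (Real.exp (S.freq j) * t)) σ (S.grad f j) := by
  have hL' := mul_eigenvector_of_modularOp hσ hL
  have he : (Real.exp (-S.freq j))⁻¹ = Real.exp (S.freq j) := by rw [Real.exp_neg, inv_inv]
  rw [LindbladData.grad_apply, LindbladData.grad_apply, map_sub, ← he,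
    modularFun_mul_left_eigenvector φ hσ.1 (Real.exp_pos _).ne' hL',
    modularFun_mul_right_eigenvector φ hσ (Real.exp_pos _).ne' hL']

variable [Fintype J]

/-- Completely positive maps commute with the adjoint, and the limit of difference quotients
inherits this. -/
lemma QuantumMarkovSemigroup.HasGenerator.map_conjTranspose {Λ : QuantumMarkovSemigroup n}
    {𝓛 : SuperOp n} (h : Λ.HasGenerator 𝓛) (f : Op n) : 𝓛 fᴴ = (𝓛 f)ᴴ := by
  have h1 := (continuous_star.tendsto (𝓛 f)).comp (h f)
  refine tendsto_nhds_unique (h fᴴ) (h1.congr fun t => ?_)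
  rw [Function.comp_apply, star_smul, star_sub, ← map_star (Λ.map t) f]
  rfl

lemma innerφ_half {σ : Op n} (hσ : σ.PosDef) (f g : Op n) :
    innerφ φHalf σ f g
      = (fᴴ * cfc (fun x : ℝ => x ^ (1 / 2 : ℝ)) σ * g * cfc (fun x : ℝ => x ^ (1 / 2 : ℝ)) σ).trace := by
  rw [innerφ, trace_weightedOp _ hσ.1, ← specForm_mul _ _ hσ.1]
  refine specForm_congr f g fun x hx y hy => ?_
  have hx0 := pos_of_mem_specFinset hσ hx
  have hy0 := pos_of_mem_specFinset hσ hy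
  rw [φHalf, Real.div_rpow hx0.le hy0.le, ← Real.sqrt_eq_rpow, ← Real.sqrt_eq_rpow]
  have h := Real.sq_sqrt hy0.le
  have h' := (Real.sqrt_pos.2 hy0).ne'
  rw [mul_div_assoc', div_eq_iff h']
  nth_rewrite 1 [← h]
  ring

lemma innerφ_half_conjTranspose {σ : Op n} (hσ : σ.PosDef) (f g : Op n) :
    (innerφ φHalf σ fᴴ gᴴ).re = (innerφ φHalf σ f g).re := by
  rw [innerφ_half hσ, innerφ_half hσ]
  have hs : (cfc (fun x : ℝ => x ^ (1 / 2 : ℝ)) σ)ᴴ = cfc (fun x : ℝ => x ^ (1 / 2 : ℝ)) σ :=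
    (cfc_predicate _ σ : IsSelfAdjoint _)
  set s := cfc (fun x : ℝ => x ^ (1 / 2 : ℝ)) σ
  have h : (fᴴ * s * g * s).trace = star (fᴴᴴ * s * gᴴ * s).trace := by
    rw [← Matrix.trace_conjTranspose]
    simp only [Matrix.conjTranspose_mul, Matrix.conjTranspose_conjTranspose, hs]
    rw [Matrix.trace_mul_comm, mul_assoc, Matrix.trace_mul_comm]
    simp only [mul_assoc]
    rw [Matrix.trace_mul_comm]
    simp only [mul_assoc]
  rw [h]
  simp

namespace LindbladData

lemma generator_apply (S : LindbladData n J) (f : Op n) :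
    S.generator f = ∑ j, (S.c j : ℂ) •
      (-((Real.exp (-S.freq j / 2) : ℂ) • ((S.L j)ᴴ * S.grad f j))
        + (Real.exp (S.freq j / 2) : ℂ) • (S.grad f j * (S.L j)ᴴ)) := by
  simp [generator, LinearMap.sum_apply, grad]

/-- The Dirichlet form as a weighted norm of the gradient. -/
lemma dirichletForm_eq {S : LindbladData n J} {σ : Op n} (hσ : σ.PosDef)
    (hL : ∀ j, modularOp σ (S.L j) = (Real.exp (-S.freq j) : ℂ) • S.L j) (φ : ℝ → ℝ) (f : Op n) :
    (dirichletForm φ σ S.generator f f).re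
      = ∑ j, S.c j * (specForm (fun x y => y *
          (Real.exp (-S.freq j / 2) * φ (Real.exp (S.freq j) * (x / y)))) σ
          (S.grad f j) (S.grad f j)).re := by
  have hW : ∀ A, weightedOp φ σ A = modularFun φ σ A * σ := fun _ => rfl
  rw [dirichletForm, innerφ, hW, generator_apply, map_sum, Finset.sum_mul, Finset.mul_sum,
    Matrix.trace_sum, Complex.neg_re, Complex.re_sum, ← Finset.sum_neg_distrib]
  refine Finset.sum_congr rfl fun j _ => ?_
  rw [← trace_weightedOp (fun t => Real.exp (-S.freq j / 2) * φ (Real.exp (S.freq j) * t)) hσ.1]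
  have hW' : weightedOp (fun t => Real.exp (-S.freq j / 2) * φ (Real.exp (S.freq j) * t)) σ
      (S.grad f j) = (Real.exp (-S.freq j / 2) : ℂ) •
        modularFun (fun t => φ (Real.exp (S.freq j) * t)) σ (S.grad f j) * σ := by
    rw [← modularFun_const_smul]; rfl
  rw [hW']
  have h1 := mul_conjTranspose_eigenvector hσ.1 (mul_eigenvector_of_modularOp hσ (hL j))
  have hc : (Real.exp (-S.freq j) : ℂ) ≠ 0 := by exact_mod_cast (Real.exp_pos _).ne'
  have h2 : σ * (S.L j)ᴴ = (((Real.exp (-S.freq j))⁻¹ : ℝ) : ℂ) • ((S.L j)ᴴ * σ) := by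
    rw [h1, smul_smul, Complex.ofReal_inv, inv_mul_cancel₀ hc, one_smul]
  -- `L̃_j*` is an eigenvector for the inverse factor `e^{ω_j}`; writing `φ` as a rescaled function
  -- puts it in the form of the intertwining lemmas.
  have hφ : φ = fun t => (fun t => φ (Real.exp (S.freq j) * t))
      ((Real.exp (-S.freq j))⁻¹⁻¹ * t) := by
    ext t
    simp only
    rw [inv_inv, ← mul_assoc, ← Real.exp_add, add_neg_cancel, Real.exp_zero, one_mul]
  set X := S.grad f j
  set Y := modularFun (fun t => φ (Real.exp (S.freq j) * t)) σ X with hY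
  have hne : (Real.exp (-S.freq j))⁻¹ ≠ 0 := inv_ne_zero (Real.exp_pos _).ne'
  have e1 : modularFun φ σ ((S.L j)ᴴ * X) = (S.L j)ᴴ * Y := by
    conv_lhs => rw [hφ]
    exact modularFun_mul_left_eigenvector (fun t => φ (Real.exp (S.freq j) * t)) hσ.1 hne h2 X
  have e2 : modularFun φ σ (X * (S.L j)ᴴ) = Y * (S.L j)ᴴ := by
    conv_lhs => rw [hφ]
    exact modularFun_mul_right_eigenvector (fun t => φ (Real.exp (S.freq j) * t)) hσ hne h2 X
  -- Moving `L̃_j*` past `σ` costs `e^{-ω_j}`, which equalises the two coefficients and lets the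
  -- terms combine into the commutator `(∂_j f)*`.
  have hexp : (Real.exp (S.freq j / 2) : ℂ) * (Real.exp (-S.freq j) : ℂ)
      = (Real.exp (-S.freq j / 2) : ℂ) := by
    rw [← Complex.ofReal_mul, ← Real.exp_add]
    congr 2
    ring
  have hX : Xᴴ = fᴴ * (S.L j)ᴴ - (S.L j)ᴴ * fᴴ := by
    simp only [X]
    rw [grad_apply, Matrix.conjTranspose_sub, Matrix.conjTranspose_mul, Matrix.conjTranspose_mul]
  rw [map_smul, map_add, map_neg, map_smul, map_smul, e1, e2, ← Complex.neg_re,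
    ← Complex.re_ofReal_mul]
  congr 1
  have e3 : (fᴴ * (Y * (S.L j)ᴴ * σ)).trace
      = (Real.exp (-S.freq j) : ℂ) * ((S.L j)ᴴ * fᴴ * (Y * σ)).trace := by
    rw [mul_assoc Y, h1, mul_smul_comm, mul_smul_comm, Matrix.trace_smul, smul_eq_mul,
      ← mul_assoc, ← mul_assoc, Matrix.trace_mul_comm]
    simp only [mul_assoc]
  rw [hX]
  simp only [smul_mul_assoc, mul_smul_comm, add_mul, neg_mul, mul_add, mul_neg, Matrix.trace_smul,
    Matrix.trace_add, Matrix.trace_neg, smul_eq_mul, sub_mul, Matrix.trace_sub, e3]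
  rw [← hexp]
  simp only [mul_assoc]
  ring

end LindbladData

end Generator

end QMS

namespace QMS

/-! ### From the Kubo–Mori to the symmetric inner product. -/

section Transfer

/-- `φ(t)² f₀(t) = t^{1/2}`: the ratio of the symmetric and the Kubo–Mori weights. -/
noncomputable def halfRatio (t : ℝ) : ℝ := Real.sqrt (φHalf t / fFreq 0 t)

lemma halfRatio_mul_self {t : ℝ} (ht : 0 < t) :
    fFreq 0 t * (halfRatio t * halfRatio t) = φHalf t := by
  have h := fFreq_pos 0 ht
  have h' : 0 ≤ φHalf t := Real.rpow_nonneg ht.le _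
  rw [halfRatio, Real.mul_self_sqrt (by positivity)]
  field_simp

/-- The logarithmic and the geometric mean are both symmetric in `x` and `y`. This makes
`halfRatio(Δ_σ)` preserve self-adjointness. -/
lemma halfRatio_div_symm {x y : ℝ} (hx : 0 < x) (hy : 0 < y) :
    halfRatio (x / y) = halfRatio (y / x) := by
  have h := weight_zero_symm hx hy
  have h1 := fFreq_pos 0 (div_pos hx hy)
  have h2 := fFreq_pos 0 (div_pos hy hx)
  have h3 : φHalf (x / y) * y = φHalf (y / x) * x := by
    rw [φHalf, φHalf, Real.div_rpow hx.le hy.le, Real.div_rpow hy.le hx.le, ← Real.sqrt_eq_rpow,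
      ← Real.sqrt_eq_rpow]
    have hx' := Real.sqrt_pos.2 hx
    have hy' := Real.sqrt_pos.2 hy
    field_simp
    rw [Real.sq_sqrt hx.le, Real.sq_sqrt hy.le, mul_comm]
  rw [halfRatio, halfRatio]
  congr 1
  rw [← mul_div_mul_right _ _ hy.ne', ← mul_div_mul_right (φHalf (y / x)) _ hx.ne', h3,
    mul_comm (fFreq 0 (x / y)), h, mul_comm x]

variable {n : Type*} [Fintype n] [DecidableEq n]

lemma innerφ_half_self_nonneg {σ : Op n} (hσ : σ.PosDef) (f : Op n) :
    0 ≤ (innerφ φHalf σ f f).re := by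
  rw [innerφ, trace_weightedOp _ hσ.1]
  refine specForm_self_nonneg f fun x hx y hy => ?_
  have hx0 := pos_of_mem_specFinset hσ hx
  have hy0 := pos_of_mem_specFinset hσ hy
  exact mul_nonneg hy0.le (Real.rpow_nonneg (div_pos hx0 hy0).le _)

lemma specForm_kuboMori_halfRatio {σ : Op n} (hσ : σ.PosDef) (f : Op n) :
    specForm (fun x y => y * fFreq 0 (x / y)) σ (modularFun halfRatio σ f)
      (modularFun halfRatio σ f) = innerφ φHalf σ f f := by
  rw [specForm_modularFun, innerφ, trace_weightedOp _ hσ.1]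
  refine specForm_congr f f fun x hx y hy => ?_
  rw [mul_assoc, halfRatio_mul_self
    (div_pos (pos_of_mem_specFinset hσ hx) (pos_of_mem_specFinset hσ hy))]

lemma trace_parallelogram {n : Type*} [Fintype n] (M : SuperOp n) (a b : Op n) :
    ((a + b)ᴴ * M (a + b)).trace + ((a - b)ᴴ * M (a - b)).trace
      = 2 * (aᴴ * M a).trace + 2 * (bᴴ * M b).trace := by
  simp only [Matrix.conjTranspose_add, Matrix.conjTranspose_sub, map_add, map_sub, add_mul,
    sub_mul, mul_add, mul_sub, Matrix.trace_add, Matrix.trace_sub]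
  ring

lemma trace_smul_I {n : Type*} [Fintype n] (M : SuperOp n) (a : Op n) :
    ((Complex.I • a)ᴴ * M (Complex.I • a)).trace = (aᴴ * M a).trace := by
  rw [map_smul, Matrix.conjTranspose_smul, smul_mul_assoc, mul_smul_comm, smul_smul]
  simp

namespace LindbladData

variable {J : Type*} [Fintype J]

/-- After intertwining, both sides carry the shifted argument `e^{ω_j} x / y`, where `f_0 h² =
φ_{1/2}` gives equality block by block. -/
lemma energyForm_halfRatio {S : LindbladData n J} {σ : Op n} (hσ : σ.PosDef)
    (hL : ∀ j, modularOp σ (S.L j) = (Real.exp (-S.freq j) : ℂ) • S.L j) (f : Op n) :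
    S.energyForm σ (S.grad (modularFun halfRatio σ f)) (S.grad (modularFun halfRatio σ f))
      = (dirichletForm φHalf σ S.generator f f).re := by
  rw [dirichletForm_eq hσ hL, energyForm]
  refine Finset.sum_congr rfl fun j _ => ?_
  rw [modularFun_grad hσ (hL j), specForm_modularFun]
  congr 2
  refine specForm_congr _ _ fun x hx y hy => ?_
  have ht := div_pos (pos_of_mem_specFinset hσ hx) (pos_of_mem_specFinset hσ hy)
  rw [fFreq_eq_fFreq_zero _ ht, ← halfRatio_mul_self (mul_pos (Real.exp_pos (S.freq j)) ht)]
  ring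

lemma innerφ_half_le_of_isHermitian [Nonempty n] {S : LindbladData n J} (hc : ∀ j, 0 < S.c j)
    {σ : Op n} (hσ : IsFullRankState σ)
    (hL : ∀ j, modularOp σ (S.L j) = (Real.exp (-S.freq j) : ℂ) • S.L j)
    {c₂ : ℝ} (hc₂ : 0 < c₂) (hTC : S.TransportCost₂ σ c₂)
    {f : Op n} (hf : f.IsHermitian) (hσf : (σ * f).trace = 0) :
    (innerφ φHalf σ f f).re ≤ c₂ * (dirichletForm φHalf σ S.generator f f).re := by
  rw [← specForm_kuboMori_halfRatio hσ.1, ← energyForm_halfRatio hσ.1 hL]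
  refine kuboMori_le_of_transportCost hc hσ hc₂ hTC ?_ ?_
  · rw [Matrix.IsHermitian, modularFun_conjTranspose (fun x hx y hy => halfRatio_div_symm
      (pos_of_mem_specFinset hσ.1 hx) (pos_of_mem_specFinset hσ.1 hy)), hf.eq]
  · rw [reTrace_apply, trace_modularFun_mul _ hσ.1, Matrix.trace_mul_comm, hσf, mul_zero,
      Complex.zero_re]

/-- Apply the self-adjoint case to `f + f*` and `i (f - f*)`. By the parallelogram law and
invariance under the adjoint, both sides add up to four times their value at `f`. -/
lemma innerφ_half_le [Nonempty n] {S : LindbladData n J} (hc : ∀ j, 0 < S.c j)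
    {σ : Op n} (hσ : IsFullRankState σ)
    (hL : ∀ j, modularOp σ (S.L j) = (Real.exp (-S.freq j) : ℂ) • S.L j)
    (hstar : ∀ f, S.generator fᴴ = (S.generator f)ᴴ)
    {c₂ : ℝ} (hc₂ : 0 < c₂) (hTC : S.TransportCost₂ σ c₂)
    {f : Op n} (hσf : (σ * f).trace = 0) :
    (innerφ φHalf σ f f).re ≤ c₂ * (dirichletForm φHalf σ S.generator f f).re := by
  have hσf' : (σ * fᴴ).trace = 0 := by
    have h := Matrix.trace_conjTranspose (σ * f)
    rwa [Matrix.conjTranspose_mul, hσ.1.1.eq, Matrix.trace_mul_comm, hσf, star_zero] at h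
  have h1 := innerφ_half_le_of_isHermitian hc hσ hL hc₂ hTC (f := f + fᴴ)
    (by rw [Matrix.IsHermitian, Matrix.conjTranspose_add, Matrix.conjTranspose_conjTranspose,
      add_comm]) (by rw [mul_add, Matrix.trace_add, hσf, hσf', add_zero])
  have h2 := innerφ_half_le_of_isHermitian hc hσ hL hc₂ hTC (f := Complex.I • (f - fᴴ))
    (by
      rw [Matrix.IsHermitian, Matrix.conjTranspose_smul, Matrix.conjTranspose_sub,
        Matrix.conjTranspose_conjTranspose, Complex.star_def, Complex.conj_I, neg_smul, ← smul_neg,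
        neg_sub])
    (by rw [mul_smul_comm, mul_sub, Matrix.trace_smul, Matrix.trace_sub, hσf, hσf', sub_zero,
      smul_zero])
  have hI : (innerφ φHalf σ (f + fᴴ) (f + fᴴ)).re
      + (innerφ φHalf σ (Complex.I • (f - fᴴ)) (Complex.I • (f - fᴴ))).re
      = 4 * (innerφ φHalf σ f f).re := by
    have h := congrArg Complex.re (trace_parallelogram (weightedOp φHalf σ) f fᴴ)
    have hs := innerφ_half_conjTranspose hσ.1 f f
    unfold innerφ at hs ⊢
    rw [trace_smul_I]
    simp only [Complex.add_re, Complex.mul_re, Complex.re_ofNat, Complex.im_ofNat, zero_mul,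
      sub_zero] at h
    linarith
  have hE : (dirichletForm φHalf σ S.generator (f + fᴴ) (f + fᴴ)).re
      + (dirichletForm φHalf σ S.generator (Complex.I • (f - fᴴ)) (Complex.I • (f - fᴴ))).re
      = 4 * (dirichletForm φHalf σ S.generator f f).re := by
    have h := congrArg Complex.re
      (trace_parallelogram (weightedOp φHalf σ ∘ₗ S.generator) f fᴴ)
    have h3 := trace_smul_I (weightedOp φHalf σ ∘ₗ S.generator) (f - fᴴ)
    have hs := innerφ_half_conjTranspose hσ.1 f (S.generator f)
    rw [← hstar] at hs
    unfold dirichletForm innerφ at *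
    simp only [LinearMap.comp_apply] at h h3
    rw [h3]
    simp only [Complex.add_re, Complex.mul_re, Complex.re_ofNat, Complex.im_ofNat, zero_mul,
      sub_zero, Complex.neg_re] at h ⊢
    linarith
  have hE' := congrArg (c₂ * ·) hE
  simp only [mul_add] at hE'
  linarith

end LindbladData

end Transfer

end QMS

theorem mainTheorem4 {n J : Type*} [Fintype n] [DecidableEq n] [Fintype J] [DecidableEq J]
    (Λ : QMS.QuantumMarkovSemigroup n) (σ : QMS.Op n) (hprim : Λ.IsPrimitive σ)
    (S : QMS.LindbladData n J) (hS : S.IsDetailedBalance σ) (hgen : Λ.HasGenerator S.generator)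
    (c₂ : ℝ) (hc₂ : 0 < c₂) (hTC : S.TransportCost₂ σ c₂) :
    (Nonempty J → 0 < (c₂ * S.κ σ)⁻¹) ∧
      QMS.PoincareInequality QMS.φHalf σ S.generator (c₂ * S.κ σ)⁻¹ := by
  obtain ⟨hσ, -, -⟩ := hprim
  have : Nonempty n := by
    by_contra h
    rw [not_nonempty_iff] at h
    exact absurd hσ.2 (by simp [Matrix.trace])
  refine ⟨fun hJ => inv_pos.2 (mul_pos hc₂ (one_pos.trans_le (S.one_le_κ hσ.1))), fun f hf => ?_⟩
  have hPI := QMS.LindbladData.innerφ_half_le hS.c_pos hσ hS.eigenvector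
    hgen.map_conjTranspose hc₂ hTC hf
  have hI := QMS.innerφ_half_self_nonneg hσ.1 f
  rcases isEmpty_or_nonempty J with hJ | hJ
  · rw [show S.κ σ = 0 from Real.iSup_of_isEmpty _, mul_zero, inv_zero, zero_mul]
    exact nonneg_of_mul_nonneg_right (hI.trans hPI) hc₂
  · have hκ := S.one_le_κ hσ.1
    have hpos : 0 < c₂ * S.κ σ := mul_pos hc₂ (one_pos.trans_le hκ)
    rw [inv_mul_le_iff₀ hpos]
    have hE := nonneg_of_mul_nonneg_right (hI.trans hPI) hc₂
    exact hPI.trans (mul_le_mul_of_nonneg_right (le_mul_of_one_le_right hc₂.le hκ) hE)
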